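/- For an abelian semigroup $(X,\cdot)$ let $\mathfrak H(X)$ be the $\mathbb Q$-vector space freely generated by all finite tuples $\boldsymbol x=(x_1,\dots,x_d)\in X^d$, $d\ge 0$. The harmonic (stuffle) product $*$ is the bilinear product on $\mathfrak H(X)$ defined inductively by $\varnothing*\boldsymbol x=\boldsymbol x*\varnothing=\boldsymbol x$ and $$\boldsymbol x*\boldsymbol y=(x_1,\boldsymbol x^{[1]}*\boldsymbol y)+(y_1,\boldsymbol x*\boldsymbol y^{[1]})+(x_1y_1,\boldsymbol x^{[1]}*\boldsymbol y^{[1]})$$ for non-empty $\boldsymbol x,\boldsymbol y$, where $\boldsymbol x^{[1]}=(x_2,\dots,x_d)$; it makes $\mathfrak H(X)$ a commutative $\mathbb Q$-algebra with unit $\varnothing$. Let $\mathfrak H_s=\mathfrak H(\mathbb C,+)$ and $\mathfrak H_q=\mathfrak H(\mathbb R_{>0},\cdot)$, whose products are written $*$ and $\underline{*}$ respectively. Powers are taken with the principal branch of the logarithm. For $\boldsymbol s\in\mathbb C^d$ with all $\Re(s_i)>1$ and $w\in\mathbb C\setminus\mathbb R_{\le -1}$ define inductively $\Psi(\varnothing;w)=1$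 and $$\Psi(\boldsymbol s;w)=\sum_{j=1}^\infty\Bigl\{\frac{\Psi(s_2,\dots,s_d;j-1)}{j^{s_1}}-\frac{\Psi(s_2,\dots,s_d;w+j-1)}{(w+j)^{s_1}}\Bigr\}\qquad(d>0).$$ For every $d\ge 0$ this function has a (necessarily unique) holomorphic continuation to $\mathbb C^d\times(\mathbb C\setminus\mathbb R_{\le -1})$, again denoted by $\Psi(\boldsymbol s;w)$. For $\boldsymbol q=(q_1,\dots,q_d)\in(\mathbb C^\times)^d$ with $-\pi<\arg q_i+\dots+\arg q_j<\pi$ for all $1\le i\le j\le d$ (in particular for $\boldsymbol q\in(\mathbb R_{>0})^d$) and $w\in\mathbb C$ define inductively $G(\varnothing;w)=1$; $G(q;w)=\frac{1-q^w}{1-q}$ if $q\ne 1$ and $G(1;w)=w$; and, for $d\ge 2$, $$G(\boldsymbol q;w)=\begin{cases}\frac{1}{1-q_d}\bigl\{G(q_1,\dots,q_{d-1};w)-G(q_1,\dots,q_{d-2},q_{d-1}q_d;w)\bigr\}&(q_d\ne 1),\\ q_{d-1}\frac{\partial}{\partial q_{d-1}}G(q_1,\dots,q_{d-1};w)&(q_d=1).\end{cases}$$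 Extend $\boldsymbol s\mapsto\Psi(\boldsymbol s;w)$ and $\boldsymbol q\mapsto G(\boldsymbol q;w)$ to $\mathbb Q$-linear maps $\Psi(-;w)\colon\mathfrak H_s\to\mathbb C$ and $G(-;w)\colon\mathfrak H_q\to\mathbb C$. **Theorem.** For every $w\in\mathbb C\setminus\mathbb R_{\le -1}$ the map $\Psi(-;w)\colon\mathfrak H_s\to\mathbb C$, and for every $w\in\mathbb C$ the map $G(-;w)\colon\mathfrak H_q\to\mathbb C$, is a $\mathbb Q$-algebra homomorphism with respect to the harmonic product. In other words, the harmonic relations $$\Psi(\boldsymbol t;w)\Psi(\boldsymbol s;w)=\Psi(\boldsymbol t*\boldsymbol s;w),\qquad G(\boldsymbol p;w)G(\boldsymbol q;w)=G(\boldsymbol p\mathbin{\underline{*}}\boldsymbol q;w)$$ hold for all tuples $\boldsymbol t,\boldsymbol s$ of complex numbers and all tuples $\boldsymbol p,\boldsymbol q$ of positive real numbers. -/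

import Mathlib

/-! ## The harmonic (stuffle, quasi-shuffle) algebra of an abelian semigroup -/

/-- The rational vector space freely generated by all tuples (finite lists) of elements of `X`. -/
def HarmonicAlgebra (X : Type*) : Type _ := List X →₀ ℚ

namespace HarmonicAlgebra

noncomputable section

variable {X : Type*}

instance : AddCommGroup (HarmonicAlgebra X) := inferInstanceAs (AddCommGroup (List X →₀ ℚ))

instance : Module ℚ (HarmonicAlgebra X) := inferInstanceAs (Module ℚ (List X →₀ ℚ))

/-- The tuples form a basis. -/
def tupleBasis (X : Type*) : Module.Basis (List X) ℚ (HarmonicAlgebra X) :=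
  Module.Basis.ofRepr (LinearEquiv.refl ℚ (List X →₀ ℚ))

/-- A tuple, regarded as an element of the harmonic algebra. -/
def tuple (x : List X) : HarmonicAlgebra X := tupleBasis X x

/-- The `ℚ`-linear extension of a function on tuples. -/
def extend {M : Type*} [AddCommGroup M] [Module ℚ M] (f : List X → M) :
    HarmonicAlgebra X →ₗ[ℚ] M :=
  (tupleBasis X).constr ℚ f

@[simp] theorem extend_tuple {M : Type*} [AddCommGroup M] [Module ℚ M] (f : List X → M)
    (x : List X) : extend f (tuple x) = f x :=
  (tupleBasis X).constr_basis ℚ f x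

instance : One (HarmonicAlgebra X) := ⟨tuple []⟩

theorem one_def : (1 : HarmonicAlgebra X) = tuple [] := rfl

/-- The linear map `x ↦ (a, x)` that puts `a` in front of a tuple. -/
def cons (a : X) : HarmonicAlgebra X →ₗ[ℚ] HarmonicAlgebra X :=
  extend fun x => tuple (a :: x)

@[simp] theorem cons_tuple (a : X) (x : List X) : cons a (tuple x) = tuple (a :: x) :=
  extend_tuple _ x

theorem induction_tuple {p : HarmonicAlgebra X → Prop} (h0 : p 0)
    (hadd : ∀ u v, p u → p v → p (u + v)) (hsmul : ∀ (c : ℚ) u, p u → p (c • u))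
    (ht : ∀ x, p (tuple x)) (u : HarmonicAlgebra X) : p u := by
  have hu : u ∈ Submodule.span ℚ (Set.range (tupleBasis X)) := by
    rw [(tupleBasis X).span_eq]; trivial
  induction hu using Submodule.span_induction with
  | mem v hv => obtain ⟨x, rfl⟩ := hv; exact ht x
  | zero => exact h0
  | add v w _ _ hv hw => exact hadd v w hv hw
  | smul c v _ hv => exact hsmul c v hv

variable [CommSemigroup X]

/-- The harmonic product of two tuples. -/
def tupleMul : List X → List X → HarmonicAlgebra X
  | [], y => tuple y
  | a :: x, [] => tuple (a :: x)
  | a :: x, b :: y =>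
      cons a (tupleMul x (b :: y)) + cons b (tupleMul (a :: x) y) + cons (a * b) (tupleMul x y)
  termination_by x y => x.length + y.length

/-- The harmonic product, extended bilinearly. -/
def mulMap : HarmonicAlgebra X →ₗ[ℚ] HarmonicAlgebra X →ₗ[ℚ] HarmonicAlgebra X :=
  extend fun x => extend fun y => tupleMul x y

instance : Mul (HarmonicAlgebra X) := ⟨fun u v => mulMap u v⟩


theorem mul_def (u v : HarmonicAlgebra X) : u * v = mulMap u v := rfl

theorem tuple_mul_tuple (x y : List X) : tuple x * tuple y = tupleMul x y := by
  simp [mul_def, mulMap]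

theorem add_mul' (u v w : HarmonicAlgebra X) : (u + v) * w = u * w + v * w := by
  simp [mul_def]

theorem mul_add' (u v w : HarmonicAlgebra X) : u * (v + w) = u * v + u * w := by
  simp [mul_def]

theorem smul_mul' (c : ℚ) (u v : HarmonicAlgebra X) : (c • u) * v = c • (u * v) := by
  simp [mul_def]

theorem mul_smul' (c : ℚ) (u v : HarmonicAlgebra X) : u * (c • v) = c • (u * v) := by
  simp [mul_def]

theorem zero_mul' (u : HarmonicAlgebra X) : 0 * u = 0 := by simp [mul_def]

theorem mul_zero' (u : HarmonicAlgebra X) : u * 0 = 0 := by simp [mul_def]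

theorem one_mul' (u : HarmonicAlgebra X) : 1 * u = u := by
  induction u using induction_tuple with
  | h0 => exact mul_zero' _
  | hadd u v hu hv => rw [mul_add', hu, hv]
  | hsmul c u hu => rw [mul_smul', hu]
  | ht x => rw [one_def, tuple_mul_tuple, tupleMul]

/-- The recursive rule for the harmonic product, with arbitrary tails. -/
theorem cons_mul_cons (a b : X) (u v : HarmonicAlgebra X) :
    cons a u * cons b v
      = cons a (u * cons b v) + cons b (cons a u * v) + cons (a * b) (u * v) := by
  induction u using induction_tuple with
  | h0 => simp [zero_mul']
  | hadd u u' hu hu' => simp only [map_add, add_mul', hu, hu']; abel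
  | hsmul c u hu => simp only [map_smul, smul_mul', hu, smul_add]
  | ht x =>
    induction v using induction_tuple with
    | h0 => simp [mul_zero']
    | hadd v v' hv hv' => simp only [map_add, mul_add', hv, hv']; abel
    | hsmul c v hv => simp only [map_smul, mul_smul', hv, smul_add]
    | ht y => simp only [cons_tuple, tuple_mul_tuple]; rw [tupleMul]

theorem mul_comm' (u v : HarmonicAlgebra X) : u * v = v * u := by
  induction u using induction_tuple with
  | h0 => rw [zero_mul', mul_zero']
  | hadd u u' hu hu' => rw [add_mul', mul_add', hu, hu']
  | hsmul c u hu => rw [smul_mul', mul_smul', hu]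
  | ht x =>
    induction v using induction_tuple with
    | h0 => rw [zero_mul', mul_zero']
    | hadd u u' hu hu' => rw [add_mul', mul_add', hu, hu']
    | hsmul c u hu => rw [smul_mul', mul_smul', hu]
    | ht y =>
      simp only [tuple_mul_tuple]
      induction x, y using tupleMul.induct with
      | case1 y => cases y <;> simp [tupleMul]
      | case2 a x => simp [tupleMul]
      | case3 a x b y h1 h2 h3 =>
        rw [tupleMul, tupleMul, h1, h2, h3, mul_comm a b]; abel

theorem tuple_mul_assoc (n : ℕ) : ∀ x y z : List X, x.length + y.length + z.length ≤ n →
    tuple x * tuple y * tuple z = tuple x * (tuple y * tuple z) := by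
  induction n with
  | zero =>
    intro x y z h
    obtain rfl : x = [] := List.length_eq_zero_iff.1 (by omega)
    simp only [← one_def, one_mul']
  | succ n ih =>
    rintro (_ | ⟨a, x⟩) y z h
    · simp only [← one_def, one_mul']
    rcases y with _ | ⟨b, y⟩
    · simp only [← one_def, one_mul', mul_comm' _ (1 : HarmonicAlgebra X)]
    rcases z with _ | ⟨c, z⟩
    · simp only [← one_def, mul_comm' _ (1 : HarmonicAlgebra X), one_mul']
    simp only [List.length_cons] at h
    have e1 := ih x (b :: y) (c :: z) (by simp only [List.length_cons]; omega)
    have e2 := ih (a :: x) y (c :: z) (by simp only [List.length_cons]; omega)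
    have e3 := ih (a :: x) (b :: y) z (by simp only [List.length_cons]; omega)
    have e4 := ih x y (c :: z) (by simp only [List.length_cons]; omega)
    have e5 := ih x (b :: y) z (by simp only [List.length_cons]; omega)
    have e6 := ih (a :: x) y z (by simp only [List.length_cons]; omega)
    have e7 := ih x y z (by omega)
    simp only [← cons_tuple] at *
    have l1 : cons a (tuple x) * cons b (tuple y) * cons c (tuple z)
        = cons a (tuple x * cons b (tuple y) * cons c (tuple z))
          + cons b (cons a (tuple x) * tuple y * cons c (tuple z))
          + cons (a * b) (tuple x * tuple y * cons c (tuple z))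
          + cons c (cons a (tuple x) * cons b (tuple y) * tuple z)
          + cons (a * c) (tuple x * cons b (tuple y) * tuple z)
          + cons (b * c) (cons a (tuple x) * tuple y * tuple z)
          + cons (a * b * c) (tuple x * tuple y * tuple z) := by
      rw [cons_mul_cons a b]
      simp only [add_mul', cons_mul_cons _ c, map_add]
      abel
    have l2 : cons a (tuple x) * (cons b (tuple y) * cons c (tuple z))
        = cons a (tuple x * (cons b (tuple y) * cons c (tuple z)))
          + cons b (cons a (tuple x) * (tuple y * cons c (tuple z)))
          + cons (a * b) (tuple x * (tuple y * cons c (tuple z)))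
          + cons c (cons a (tuple x) * (cons b (tuple y) * tuple z))
          + cons (a * c) (tuple x * (cons b (tuple y) * tuple z))
          + cons (b * c) (cons a (tuple x) * (tuple y * tuple z))
          + cons (a * b * c) (tuple x * (tuple y * tuple z)) := by
      rw [cons_mul_cons b c]
      simp only [mul_add', cons_mul_cons a _, map_add, mul_assoc]
      abel
    rw [l1, l2, e1, e2, e3, e4, e5, e6, e7]

theorem mul_assoc' (u v w : HarmonicAlgebra X) : u * v * w = u * (v * w) := by
  induction u using induction_tuple with
  | h0 => simp only [zero_mul']
  | hadd u u' hu hu' => simp only [add_mul', hu, hu']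
  | hsmul c u hu => simp only [smul_mul', hu]
  | ht x =>
    induction v using induction_tuple with
    | h0 => simp only [zero_mul', mul_zero']
    | hadd u u' hu hu' => simp only [add_mul', mul_add', hu, hu']
    | hsmul c u hu => simp only [smul_mul', mul_smul', hu]
    | ht y =>
      induction w using induction_tuple with
      | h0 => simp only [mul_zero']
      | hadd u u' hu hu' => simp only [mul_add', hu, hu']
      | hsmul c u hu => simp only [mul_smul', hu]
      | ht z => exact tuple_mul_assoc _ x y z le_rfl

/-- The harmonic product makes the space of tuples a commutative ring with unit `∅`. -/
instance : CommRing (HarmonicAlgebra X) :=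
  { (inferInstance : AddCommGroup (HarmonicAlgebra X)) with
    mul := (· * ·)
    one := 1
    left_distrib := mul_add'
    right_distrib := add_mul'
    zero_mul := zero_mul'
    mul_zero := mul_zero'
    mul_assoc := mul_assoc'
    one_mul := one_mul'
    mul_one := fun u => by rw [mul_comm', one_mul']
    mul_comm := mul_comm' }

instance : Algebra ℚ (HarmonicAlgebra X) := Algebra.ofModule smul_mul' mul_smul'

end

end HarmonicAlgebra

/-- The harmonic algebra on tuples of complex numbers; the semigroup is `(ℂ, +)`. -/
abbrev HarmonicAlgebraS : Type := HarmonicAlgebra (Multiplicative ℂ)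

/-- The harmonic algebra on tuples of positive real numbers; the semigroup is `(ℝ_{>0}, ·)`. -/
abbrev HarmonicAlgebraQ : Type := HarmonicAlgebra {x : ℝ // 0 < x}

noncomputable section

/-! ## The function `Ψ` -/

/-- The series that defines `Ψ(s; w)` when all `s i` have real part greater than `1`; the summation
index `j` of the code is the usual one, which starts at `1`, minus `1`. -/
def psiSeries : List ℂ → ℂ → ℂ
  | [], _ => 1
  | s₁ :: s, w => ∑' j : ℕ,
      (psiSeries s j / ((j : ℂ) + 1) ^ s₁ - psiSeries s (w + j) / (w + (j + 1)) ^ s₁)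

/-- The complex plane without the real numbers `≤ -1`. -/
def psiDomain : Set ℂ := {w | ∀ x : ℝ, x ≤ -1 → w ≠ x}

/-- `F` is a holomorphic continuation of the series `Ψ(s; w)` in `d` variables `s` to all
`s ∈ ℂ^d` and all `w ∉ ℝ_{≤ -1}`. -/
structure IsPsiContinuation (d : ℕ) (F : (Fin d → ℂ) × ℂ → ℂ) : Prop where
  differentiableOn : DifferentiableOn ℂ F (Set.univ ×ˢ psiDomain)
  eq_series : ∀ s : Fin d → ℂ, (∀ i, 1 < (s i).re) → ∀ w ∈ psiDomain,
    F (s, w) = psiSeries (List.ofFn s) w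

/-- The continuation is unique. -/
theorem IsPsiContinuation.unique {d : ℕ} {F F' : (Fin d → ℂ) × ℂ → ℂ}
    (h : IsPsiContinuation d F) (h' : IsPsiContinuation d F') (s : Fin d → ℂ) (w : ℂ)
    (hw : w ∈ psiDomain) : F (s, w) = F' (s, w) := by
  let g : ℂ → (Fin d → ℂ) × ℂ := fun z => ((fun i => 2 + z * (s i - 2)), w)
  have hg : Differentiable ℂ g := by fun_prop
  have key : ∀ H, IsPsiContinuation d H → AnalyticOnNhd ℂ (H ∘ g) Set.univ := fun H hH =>
    (DifferentiableOn.comp hH.differentiableOn hg.differentiableOn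
      (fun z _ => ⟨trivial, hw⟩)).analyticOnNhd isOpen_univ
  have hev : (F ∘ g) =ᶠ[nhds 0] (F' ∘ g) := by
    have hre : ∀ᶠ z : ℂ in nhds 0, ∀ i, 1 < (2 + z * (s i - 2)).re := by
      refine Filter.eventually_all.2 fun i => ?_
      have hc : Continuous fun z : ℂ => (2 + z * (s i - 2)).re := by fun_prop
      exact hc.continuousAt.eventually_const_lt (by simp)
    filter_upwards [hre] with z hz
    exact (h.eq_series _ hz w hw).trans (h'.eq_series _ hz w hw).symm
  have := congrFun ((key F h).eq_of_eventuallyEq (key F' h') hev) 1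
  simpa [g] using this

/-- The holomorphic continuation of `Ψ` in `d` variables `s`. -/
def psiContinuation (d : ℕ) : (Fin d → ℂ) × ℂ → ℂ := Classical.epsilon (IsPsiContinuation d)

/-- The value `Ψ(s; w)` at a tuple `s` of arbitrary complex numbers. -/
def Psi (s : List ℂ) (w : ℂ) : ℂ := psiContinuation s.length (s.get, w)

/-- The `ℚ`-linear map `Ψ(-; w)`. -/
def psiMap (w : ℂ) : HarmonicAlgebraS →ₗ[ℚ] ℂ :=
  HarmonicAlgebra.extend fun s => Psi (s.map Multiplicative.toAdd) w

/-! ## The function `G` -/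

/-- `gAux [q_{d-1}, …, q_1] q_d w` is `G(q_1, …, q_d; w)`. -/
def gAux : List ℂ → ℂ → ℂ → ℂ
  | [], q, w => if q = 1 then w else (1 - q ^ w) / (1 - q)
  | p :: l, q, w =>
      if q = 1 then p * deriv (fun z => gAux l z w) p
      else (gAux l p w - gAux l (p * q) w) / (1 - q)

/-- The function `G(q; w)`, defined by recursion on the last entry of the tuple `q`. It is used
only where no partial product of consecutive entries crosses the branch cut of the power, in
particular at tuples of positive real numbers. -/
def G (q : List ℂ) (w : ℂ) : ℂ :=
  match q.reverse with
  | [] => 1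
  | a :: l => gAux l a w

/-- The `ℚ`-linear map `G(-; w)`. -/
def gMap (w : ℂ) : HarmonicAlgebraQ →ₗ[ℚ] ℂ :=
  HarmonicAlgebra.extend fun q => G (q.map fun x : {x : ℝ // 0 < x} => ((x : ℝ) : ℂ)) w

end

/-! Both functions are iterated indefinite sums. Put `e(a; w) = (w + 1) ^ (-a)` for `Ψ` and `e(a; w)
= a ^ w` for `G`. In either case `e` turns the semigroup operation into multiplication, `Φ(a, x; w +
1) - Φ(a, x; w) = e(a; w) Φ(x; w)`, and `Φ(a, x; 0) = 0`. The discrete product rule `Δ(FH) = ΔF · H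
+ F · ΔH + ΔF · ΔH` has the shape of the recursion for the harmonic product. So, by induction on the
tuples, the two sides of the harmonic relation have the same difference and the same value at `0`.
Their discrepancy is `1`-periodic, and polynomial growth on a single strip forces it to vanish
(`IsShiftDomain.eq_zero_of_periodic`). This is `HarmonicAlgebra.extend_tupleMul_apply`; what remains
is to check its hypotheses.

For `G`, the recursion is an iterated divided difference at `1` in the last variable, starting from
`q ^ w`. The difference equation passes through divided differences (`gAux_append_add_one`), and
growth follows by controlling all derivatives in `q` at positive reals (`hasDerivsIn_gAux`).

For `Ψ`, the continuation must be constructed as well. If `f` is holomorphic with growth of order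
`B`, the series `∑ (f j - f (j + w))` may diverge. Replacing the constant `f j` by a Newton
interpolation polynomial of `f` at `j, j + 1, …` makes the terms `O(j⁻²)`, and an explicit
polynomial in `w` repairs the difference equation (`HasGrowth.newtonSum_add_one`). The result is
holomorphic in parameters and again of polynomial growth, so the construction iterates to `psiSum`.
Uniqueness of indefinite sums identifies `psiSum` with the original series when all real parts
exceed `1` (`psiSeries_eq_psiSum`). -/

noncomputable section

open Set Metric

/-! ### Periodic functions of polynomial growth -/

/-- An entire function of period `1` that grows at most polynomially is constant. -/
theorem Complex.eq_apply_zero_of_periodic_of_norm_le (A : ℕ) : ∀ {f : ℂ → ℂ} {C : ℝ},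
    Differentiable ℂ f → Function.Periodic f 1 → (∀ z, ‖f z‖ ≤ C * (1 + ‖z‖) ^ A) →
    ∀ z, f z = f 0 := by
  induction A with
  | zero =>
    intro f C hf _ hb z
    refine hf.apply_eq_apply_of_bounded (isBounded_iff_forall_norm_le.2 ⟨C, ?_⟩) z 0
    rintro _ ⟨w, rfl⟩
    simpa using hb w
  | succ A ih =>
    intro f C hf hp hb
    have hC : 0 ≤ C := by
      have := (norm_nonneg _).trans (hb 0)
      simpa using this
    have hd : Differentiable ℂ (deriv f) := hf.deriv
    have hdp : Function.Periodic (deriv f) 1 := fun z => by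
      rw [← deriv_comp_add_const]
      congr 1
      exact funext hp
    have hdb : ∀ z, ‖deriv f z‖ ≤ C * 2 ^ (A + 1) * (1 + ‖z‖) ^ A := by
      intro z
      -- Cauchy's estimate on a circle whose radius is comparable to `1 + ‖z‖` lowers the growth
      -- exponent by one.
      have hR : 0 < 1 + ‖z‖ := by positivity
      have := Complex.norm_deriv_le_of_forall_mem_sphere_norm_le (c := z) (C := C * (2 * (1 + ‖z‖)) ^ (A + 1))
        hR hf.diffContOnCl (fun w hw => by
          refine (hb w).trans ?_
          have : ‖w‖ ≤ ‖z‖ + (1 + ‖z‖) := by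
            have h1 : ‖w - z‖ = 1 + ‖z‖ := by simpa using hw
            calc ‖w‖ = ‖z + (w - z)‖ := by ring_nf
              _ ≤ _ := (norm_add_le _ _).trans (by rw [h1])
          gcongr
          linarith)
      refine this.trans (le_of_eq ?_)
      rw [mul_pow, pow_succ (1 + ‖z‖)]
      field_simp
    have hconst := ih hd hdp hdb
    have hlin : ∀ z, f z = f 0 + deriv f 0 * z := by
      have hg : Differentiable ℂ fun z => f z - deriv f 0 * z := by fun_prop
      have := is_const_of_deriv_eq_zero hg (fun z => by
        rw [deriv_fun_sub (hf z) (by fun_prop), deriv_const_mul _ (by fun_prop), hconst z]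
        simp)
      intro z
      have := this z 0
      simp only [mul_zero, sub_zero] at this
      rw [← this]; ring
    have h1 : deriv f 0 = 0 := by
      have e1 := hlin 1
      have e2 := hp 0
      rw [zero_add] at e2
      rw [e2] at e1
      simpa using e1
    intro z
    rw [hlin z, h1]; simp

/-- Functions that are holomorphic on `D` and polynomially bounded on the strip `0 ≤ Re w ≤ 1`. -/
def stripAlgebra (D : Set ℂ) : Subalgebra ℂ (ℂ → ℂ) where
  carrier := {u | DifferentiableOn ℂ u D ∧
    ∃ (C : ℝ) (A : ℕ), ∀ w : ℂ, 0 ≤ w.re → w.re ≤ 1 → ‖u w‖ ≤ C * (1 + ‖w‖) ^ A}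
  mul_mem' := by
    rintro u v ⟨hu, C, A, hC⟩ ⟨hv, C', A', hC'⟩
    refine ⟨hu.mul hv, C * C', A + A', fun w h0 h1 => ?_⟩
    rw [Pi.mul_apply, norm_mul, pow_add]
    calc ‖u w‖ * ‖v w‖ ≤ (C * (1 + ‖w‖) ^ A) * (C' * (1 + ‖w‖) ^ A') :=
          mul_le_mul (hC w h0 h1) (hC' w h0 h1) (norm_nonneg _) ((norm_nonneg _).trans (hC w h0 h1))
      _ = _ := by ring
  add_mem' := by
    rintro u v ⟨hu, C, A, hC⟩ ⟨hv, C', A', hC'⟩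
    refine ⟨hu.add hv, |C| + |C'|, A + A', fun w h0 h1 => ?_⟩
    have h : 1 ≤ 1 + ‖w‖ := by linarith [norm_nonneg w]
    calc ‖(u + v) w‖ ≤ ‖u w‖ + ‖v w‖ := norm_add_le _ _
      _ ≤ C * (1 + ‖w‖) ^ A + C' * (1 + ‖w‖) ^ A' := add_le_add (hC w h0 h1) (hC' w h0 h1)
      _ ≤ |C| * (1 + ‖w‖) ^ (A + A') + |C'| * (1 + ‖w‖) ^ (A + A') := by
          gcongr
          all_goals first | exact le_abs_self _ | exact h | omega
      _ = _ := by ring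
  algebraMap_mem' := by
    intro c
    refine ⟨differentiableOn_const _, ‖c‖, 0, fun w _ _ => ?_⟩
    simp [Pi.algebraMap_apply]

/-- An open set of complex numbers that contains the half plane `Re w > -1` and is stable under
`w ↦ w + 1`. -/
structure IsShiftDomain (D : Set ℂ) : Prop where
  isOpen : IsOpen D
  mem_of_re : ∀ w : ℂ, -1 < w.re → w ∈ D
  add_one : ∀ w ∈ D, w + 1 ∈ D

theorem IsShiftDomain.add_nat {D : Set ℂ} (hD : IsShiftDomain D) {w : ℂ} (hw : w ∈ D) (n : ℕ) :
    w + n ∈ D := by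
  induction n with
  | zero => simpa using hw
  | succ n ih => simpa [add_assoc] using hD.add_one _ ih

theorem IsShiftDomain.zero_mem {D : Set ℂ} (hD : IsShiftDomain D) : (0 : ℂ) ∈ D :=
  hD.mem_of_re 0 (by simp)

theorem isShiftDomain_univ : IsShiftDomain univ := ⟨isOpen_univ, fun _ _ => trivial, fun _ _ => trivial⟩

/-- A function of `stripAlgebra D` that is invariant under `w ↦ w + 1` and vanishes at `0`
vanishes on `D`. -/
theorem IsShiftDomain.eq_zero_of_periodic {D : Set ℂ} (hD : IsShiftDomain D) {u : ℂ → ℂ}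
    (hu : u ∈ stripAlgebra D) (hp : ∀ w ∈ D, u (w + 1) = u w) (h0 : u 0 = 0) :
    ∀ w ∈ D, u w = 0 := by
  obtain ⟨hd, C, A, hC⟩ := hu
  have hpn : ∀ w ∈ D, ∀ n : ℕ, u (w + n) = u w := by
    intro w hw n
    induction n with
    | zero => simp
    | succ n ih => rw [Nat.cast_succ, ← add_assoc, hp _ (hD.add_nat hw n), ih]
  have key : ∀ (z : ℂ) (a b : ℕ), z + a ∈ D → z + b ∈ D → u (z + a) = u (z + b) := by
    intro z a b ha hb
    rcases le_total a b with h | h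
    · obtain ⟨c, rfl⟩ := Nat.exists_eq_add_of_le h
      rw [Nat.cast_add, ← add_assoc, hpn _ ha]
    · obtain ⟨c, rfl⟩ := Nat.exists_eq_add_of_le h
      rw [Nat.cast_add, ← add_assoc, hpn _ hb]
  -- `U` is the entire extension of `u`: move `z` to the right until it lies in `D`, and use
  -- periodicity to see that the number of shifts is irrelevant.
  let n : ℂ → ℕ := fun z => ⌈|z.re|⌉₊
  have hn : ∀ z, z + n z ∈ D := fun z => hD.mem_of_re _ (by
    have h1 := Nat.le_ceil |z.re|
    have h2 := neg_abs_le z.re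
    simp only [Complex.add_re, Complex.natCast_re, n]
    linarith)
  let U : ℂ → ℂ := fun z => u (z + n z)
  have hUu : ∀ (z : ℂ) (N : ℕ), z + N ∈ D → U z = u (z + N) := fun z N hN => key z _ _ (hn z) hN
  have hU0 : ∀ z ∈ D, U z = u z := fun z hz => by
    have := hUu z 0 (by simpa using hz)
    simpa using this
  -- `n` is only locally bounded, but the fixed shift `n z` serves the whole unit ball around `z`:
  -- it reaches `Re ≥ 0` at `z`, and `D` contains `Re > -1`.
  have hUd : Differentiable ℂ U := by
    intro z
    have hev : U =ᶠ[nhds z] fun y => u (y + n z) := by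
      filter_upwards [ball_mem_nhds z one_pos] with y hy
      refine hUu y _ (hD.mem_of_re _ ?_)
      have h1 := Nat.le_ceil |z.re|
      have h2 := neg_abs_le z.re
      have h3 : |(y - z).re| < 1 := (Complex.abs_re_le_norm _).trans_lt (by simpa [dist_eq_norm] using hy)
      rw [Complex.sub_re] at h3
      have h4 := (abs_lt.1 h3).1
      simp only [Complex.add_re, Complex.natCast_re, n]
      linarith
    refine DifferentiableAt.congr_of_eventuallyEq ?_ hev
    have := (hd.differentiableAt (hD.isOpen.mem_nhds (hn z)))
    exact this.comp z (by fun_prop)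
  have hUp : Function.Periodic U 1 := by
    intro z
    have h1 := hUu z (1 + n (z + 1)) (by
      have := hn (z + 1)
      push_cast
      rwa [← add_assoc])
    rw [h1]
    push_cast
    rw [← add_assoc]
  have hUb : ∀ z, ‖U z‖ ≤ (|C| * 2 ^ A) * (1 + ‖z‖) ^ A := by
    intro z
    have e : U z = U (z - ⌊z.re⌋) := by
      have := hUp.sub_zsmul_eq ⌊z.re⌋ (x := z)
      rw [← this]
      simp
    have hre : (z - ⌊z.re⌋).re = Int.fract z.re := by simp
    have him : (z - ⌊z.re⌋).im = z.im := by simp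
    have r0 := Int.fract_nonneg z.re
    have r1 := (Int.fract_lt_one z.re).le
    rw [e, hU0 _ (hD.mem_of_re _ (by rw [hre]; linarith))]
    refine (hC _ (by rw [hre]; exact r0) (by rw [hre]; exact r1)).trans ?_
    have hn1 : ‖z - ⌊z.re⌋‖ ≤ 1 + ‖z‖ := by
      refine (Complex.norm_le_abs_re_add_abs_im _).trans ?_
      rw [hre, him, abs_of_nonneg r0]
      exact add_le_add r1 (Complex.abs_im_le_norm z)
    calc C * (1 + ‖z - ⌊z.re⌋‖) ^ A ≤ |C| * (2 * (1 + ‖z‖)) ^ A := by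
          gcongr
          · exact le_abs_self C
          · linarith [norm_nonneg z]
      _ = _ := by rw [mul_pow]; ring
  intro w hw
  rw [← hU0 w hw, Complex.eq_apply_zero_of_periodic_of_norm_le A hUd hUp hUb w, hU0 0 hD.zero_mem, h0]

/-! ### Harmonic relations for iterated indefinite sums -/

namespace HarmonicAlgebra

/-- Iterated indefinite sums of a multiplicative family `e` of functions satisfy the harmonic
relations. -/
theorem extend_tupleMul_apply {X : Type*} [CommSemigroup X] {D : Set ℂ} (hD : IsShiftDomain D)
    {e : X → ℂ → ℂ} (he : ∀ a b, ∀ w ∈ D, e (a * b) w = e a w * e b w)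
    {Φ : List X → ℂ → ℂ} (hnil : ∀ w ∈ D, Φ [] w = 1) (hmem : ∀ x, Φ x ∈ stripAlgebra D)
    (hzero : ∀ a x, Φ (a :: x) 0 = 0)
    (hdiff : ∀ a x, ∀ w ∈ D, Φ (a :: x) (w + 1) = Φ (a :: x) w + e a w * Φ x w) (x y : List X) :
    ∀ w ∈ D, extend (fun l => Φ l w) (tuple x * tuple y) = Φ x w * Φ y w := by
  have hEmem : ∀ u : HarmonicAlgebra X, (fun w => extend (fun l => Φ l w) u) ∈ stripAlgebra D := by
    intro u
    induction u using induction_tuple with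
    | h0 => simp only [map_zero]; exact (stripAlgebra D).zero_mem
    | hadd u v hu hv => simp only [map_add]; exact (stripAlgebra D).add_mem hu hv
    | hsmul c u hu =>
      have := (stripAlgebra D).smul_mem hu (c : ℂ)
      convert this using 1
      ext w
      simp [Rat.smul_def]
    | ht x => simpa using hmem x
  have hE0 : ∀ a (u : HarmonicAlgebra X), extend (fun l => Φ l 0) (cons a u) = 0 := by
    intro a u
    induction u using induction_tuple with
    | h0 => simp
    | hadd u v hu hv => simp [hu, hv]
    | hsmul c u hu => simp [hu]
    | ht x => simpa using hzero a x
  have hEd : ∀ a (u : HarmonicAlgebra X), ∀ w ∈ D, extend (fun l => Φ l (w + 1)) (cons a u)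
      = extend (fun l => Φ l w) (cons a u) + e a w * extend (fun l => Φ l w) u := by
    intro a u w hw
    induction u using induction_tuple with
    | h0 => simp
    | hadd u v hu hv => simp only [map_add, hu, hv]; ring
    | hsmul c u hu => simp only [map_smul, hu, Rat.smul_def]; ring
    | ht x => simpa using hdiff a x w hw
  simp only [tuple_mul_tuple]
  induction x, y using tupleMul.induct with
  | case1 y => intro w hw; simp [tupleMul, hnil w hw]
  | case2 a x => intro w hw; simp [tupleMul, hnil w hw]
  | case3 a x b y h1 h2 h3 =>
    have hm : ((fun w => extend (fun l => Φ l w) (tupleMul (a :: x) (b :: y)))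
        - Φ (a :: x) * Φ (b :: y)) ∈ stripAlgebra D :=
      (stripAlgebra D).sub_mem (hEmem _) ((stripAlgebra D).mul_mem (hmem _) (hmem _))
    have := hD.eq_zero_of_periodic hm ?_ ?_
    · intro w hw
      exact sub_eq_zero.1 (this w hw)
    · intro w hw
      simp only [Pi.sub_apply, Pi.mul_apply]
      rw [tupleMul]
      -- The discrete product rule: the three increments coming from the recursion are the three
      -- increments of the product.
      simp only [map_add, hEd _ _ w hw, h1 w hw, h2 w hw, h3 w hw, hdiff _ _ w hw, he a b w hw]
      ring
    · simp only [Pi.sub_apply, Pi.mul_apply]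
      rw [tupleMul]
      simp [hE0, hzero]

end HarmonicAlgebra

/-! ### The function `G`: difference equation and growth -/

section

open Complex

theorem Complex.ofReal_mul_mem_slitPlane {p : ℝ} (hp : 0 < p) {q : ℂ} (hq : q ∈ slitPlane) :
    (p : ℂ) * q ∈ slitPlane := by
  rw [mem_slitPlane_iff] at hq ⊢
  rw [re_ofReal_mul, im_ofReal_mul]
  rcases hq with h | h
  · exact Or.inl (mul_pos hp h)
  · exact Or.inr (mul_ne_zero hp.ne' h)

theorem Complex.ofReal_mul_cpow {p : ℝ} (hp : 0 < p) (q w : ℂ) :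
    ((p : ℂ) * q) ^ w = (p : ℂ) ^ w * q ^ w := by
  rcases eq_or_ne q 0 with rfl | hq
  · rcases eq_or_ne w 0 with rfl | hw
    · simp
    · simp [zero_cpow hw]
  · have hp' : (p : ℂ) ≠ 0 := ofReal_ne_zero.2 hp.ne'
    rw [cpow_def_of_ne_zero (mul_ne_zero hp' hq), cpow_def_of_ne_zero hp', cpow_def_of_ne_zero hq,
      log_ofReal_mul hp hq, ofReal_log hp.le, add_mul, exp_add]

/-- The two branches of the definition are the two branches of one divided difference at `1`, so the
point `q = 1` becomes a removable singularity. The same holds for `gAux_cons`. -/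
theorem gAux_nil (q w : ℂ) : gAux [] q w = dslope (fun z => z ^ w) 1 q := by
  rw [gAux]
  split_ifs with h
  · rw [h, dslope_same]
    have := (hasDerivAt_id (1 : ℂ)).cpow_const (c := w) (Or.inl (by simp))
    simpa using this.deriv.symm
  · rw [dslope_of_ne _ h, slope_def_field, one_cpow, ← neg_sub (q ^ w), ← neg_sub q, neg_div_neg_eq]

theorem gAux_cons (p : ℂ) (l : List ℂ) (q w : ℂ) :
    gAux (p :: l) q w = dslope (fun z => gAux l (p * z) w) 1 q := by
  rw [gAux]
  split_ifs with h
  · rw [h, dslope_same, deriv_comp_mul_left p (fun z => gAux l z w)]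
    simp
  · rw [dslope_of_ne _ h, slope_def_field, mul_one, ← neg_sub (gAux l (p * q) w), ← neg_sub q,
      neg_div_neg_eq]

theorem gAux_apply_zero (l : List ℂ) (q : ℂ) : gAux l q 0 = 0 := by
  induction l generalizing q with
  | nil => simp [gAux]
  | cons p l ih => simp [gAux, ih]

theorem DifferentiableOn.iteratedDeriv_of_isOpen {f : ℂ → ℂ} {s : Set ℂ} (hf : DifferentiableOn ℂ f s)
    (hs : IsOpen s) (k : ℕ) : DifferentiableOn ℂ (iteratedDeriv k f) s := by
  induction k with
  | zero => simpa using hf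
  | succ k ih => rw [iteratedDeriv_succ]; exact ih.deriv hs

theorem iteratedDeriv_comp_mul_left_apply (f : ℂ → ℂ) (p : ℂ) (k : ℕ) (z : ℂ) :
    iteratedDeriv k (fun z => f (p * z)) z = p ^ k * iteratedDeriv k f (p * z) := by
  induction k generalizing z with
  | zero => simp
  | succ k ih =>
    rw [iteratedDeriv_succ, funext ih, deriv_const_mul_field,
      deriv_comp_mul_left p (iteratedDeriv k f), iteratedDeriv_succ, pow_succ, smul_eq_mul]
    ring

/-- The Leibniz rule for `(z - a) * dslope g a z = g z - g a`. -/
theorem iteratedDeriv_dslope_relation {g : ℂ → ℂ} {s : Set ℂ} (hs : IsOpen s) {a : ℂ} (ha : a ∈ s)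
    (hg : DifferentiableOn ℂ g s) (k : ℕ) : ∀ z ∈ s,
    (z - a) * iteratedDeriv (k + 1) (dslope g a) z + (k + 1) * iteratedDeriv k (dslope g a) z
      = iteratedDeriv (k + 1) g z := by
  have hψ : DifferentiableOn ℂ (dslope g a) s := (differentiableOn_dslope (hs.mem_nhds ha)).2 hg
  have hd : ∀ k, ∀ z ∈ s, DifferentiableAt ℂ (iteratedDeriv k (dslope g a)) z := fun k z hz =>
    (hψ.iteratedDeriv_of_isOpen hs k).differentiableAt (hs.mem_nhds hz)
  induction k with
  | zero =>
    intro z hz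
    have e : g = fun z => (z - a) * dslope g a z + g a := by
      ext z
      have := sub_smul_dslope g a z
      rw [smul_eq_mul] at this
      rw [this]; ring
    have h0 := hd 0 z hz
    rw [iteratedDeriv_zero] at h0
    simp only [zero_add, iteratedDeriv_one, iteratedDeriv_zero]
    conv_rhs => rw [e]
    rw [deriv_add_const, deriv_fun_mul (by fun_prop) h0]
    simp
    ring
  | succ k ih =>
    intro z hz
    have hev : (fun z => (z - a) * iteratedDeriv (k + 1) (dslope g a) z
        + (k + 1) * iteratedDeriv k (dslope g a) z) =ᶠ[nhds z] iteratedDeriv (k + 1) g := by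
      filter_upwards [hs.mem_nhds hz] with y hy using ih y hy
    have h1 := hd (k + 1) z hz
    have h0 := hd k z hz
    rw [iteratedDeriv_succ (n := k + 1) (f := g), ← hev.deriv_eq,
      deriv_fun_add (by fun_prop) (by fun_prop), deriv_fun_mul (by fun_prop) h1,
      deriv_const_mul _ h0, ← iteratedDeriv_succ, ← iteratedDeriv_succ]
    simp
    ring

/-- `φ (q, w)` is holomorphic in `q` on the slit plane, and all its derivatives in `q` at positive
real `q` belong to `V` as functions of `w`. -/
def HasDerivsIn (V : Submodule ℂ (ℂ → ℂ)) (φ : ℂ → ℂ → ℂ) : Prop :=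
  (∀ w, DifferentiableOn ℂ (fun q => φ q w) slitPlane) ∧
    ∀ q : ℝ, 0 < q → ∀ k : ℕ, (fun w => iteratedDeriv k (fun z => φ z w) q) ∈ V

theorem HasDerivsIn.apply_mem {V : Submodule ℂ (ℂ → ℂ)} {φ : ℂ → ℂ → ℂ} (h : HasDerivsIn V φ)
    {q : ℝ} (hq : 0 < q) : φ q ∈ V := by
  simpa using h.2 q hq 0

/-- Solve the Leibniz relation for the derivatives of the divided difference `ψ` of `g`. At `q = 1`
its first term drops out, and the derivative of `ψ` of order `k` is that of `g` of order `k + 1`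
over `k + 1`; this is why all derivatives must be controlled at once. At `q ≠ 1`, divide by `q - 1`
and induct on `k`. -/
theorem HasDerivsIn.dslope {V : Submodule ℂ (ℂ → ℂ)} {φ : ℂ → ℂ → ℂ} (h : HasDerivsIn V φ)
    {p : ℝ} (hp : 0 < p) : HasDerivsIn V fun q w => dslope (fun z => φ (p * z) w) 1 q := by
  have hg : ∀ w, DifferentiableOn ℂ (fun z => φ (p * z) w) slitPlane := fun w =>
    (h.1 w).comp (by fun_prop) fun z hz => ofReal_mul_mem_slitPlane hp hz
  refine ⟨fun w => (differentiableOn_dslope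
    (isOpen_slitPlane.mem_nhds one_mem_slitPlane)).2 (hg w), fun q hq k => ?_⟩
  have hqs : (q : ℂ) ∈ slitPlane := ofReal_mem_slitPlane.2 hq
  have hrel := fun w k => iteratedDeriv_dslope_relation isOpen_slitPlane one_mem_slitPlane (hg w) k q hqs
  have hV : ∀ k, (fun w => iteratedDeriv k (fun z => φ (p * z) w) q) ∈ V := by
    intro k
    have := V.smul_mem ((p : ℂ) ^ k) (h.2 (p * q) (mul_pos hp hq) k)
    convert this using 1
    ext w
    rw [iteratedDeriv_comp_mul_left_apply (fun z => φ z w)]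
    simp
  rcases eq_or_ne q 1 with rfl | hq1
  · have := V.smul_mem ((k + 1 : ℂ)⁻¹) (hV (k + 1))
    convert this using 1
    ext w
    have hk : (k + 1 : ℂ) ≠ 0 := Nat.cast_add_one_ne_zero k
    rw [Pi.smul_apply, smul_eq_mul, ← hrel w k]
    field_simp
    simp
  · have hq1' : (q : ℂ) - 1 ≠ 0 := sub_ne_zero.2 (by exact_mod_cast hq1)
    induction k with
    | zero =>
      have h1 := h.apply_mem (mul_pos hp hq)
      have h2 := h.apply_mem hp
      convert V.smul_mem (((q : ℂ) - 1)⁻¹) (V.sub_mem h1 h2) using 1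
      ext w
      have := sub_smul_dslope (fun z => φ (p * z) w) 1 (q : ℂ)
      simp only [smul_eq_mul, mul_one] at this
      rw [Pi.smul_apply, Pi.sub_apply, iteratedDeriv_zero, ofReal_mul, ← this, smul_eq_mul,
        inv_mul_cancel_left₀ hq1']
    | succ k ih =>
      convert V.smul_mem (((q : ℂ) - 1)⁻¹) (V.sub_mem (hV (k + 1)) (V.smul_mem (k + 1 : ℂ) ih)) using 1
      ext w
      rw [Pi.smul_apply, Pi.sub_apply, Pi.smul_apply, ← hrel w k, smul_eq_mul, smul_eq_mul,
        add_sub_cancel_right, inv_mul_cancel_left₀ hq1']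

theorem ofReal_cpow_mem_stripAlgebra {q : ℝ} (hq : 0 < q) :
    (fun w : ℂ => (q : ℂ) ^ w) ∈ stripAlgebra univ := by
  have hq' : (q : ℂ) ≠ 0 := ofReal_ne_zero.2 hq.ne'
  refine ⟨fun w _ => ?_, 1 + q, 0, fun w h0 h1 => ?_⟩
  · exact (differentiableAt_id.const_cpow (Or.inl hq')).differentiableWithinAt
  · rw [norm_cpow_eq_rpow_re_of_pos hq, pow_zero, mul_one]
    rcases le_total 1 q with h | h
    · have := Real.rpow_le_rpow_of_exponent_le h h1
      rw [Real.rpow_one] at this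
      linarith
    · have := Real.rpow_le_one hq.le h h0
      linarith

theorem id_mem_stripAlgebra (D : Set ℂ) : (fun w : ℂ => w) ∈ stripAlgebra D :=
  ⟨differentiableOn_id, 1, 1, fun w _ _ => by simp⟩

theorem iteratedDeriv_cpow_const (w : ℂ) (k : ℕ) : ∀ z ∈ slitPlane,
    iteratedDeriv k (fun z => z ^ w) z = (∏ i ∈ Finset.range k, (w - i)) * z ^ (w - k) := by
  induction k with
  | zero => simp
  | succ k ih =>
    intro z hz
    have hev : iteratedDeriv k (fun z => z ^ w) =ᶠ[nhds z]
        fun z => (∏ i ∈ Finset.range k, (w - i)) * z ^ (w - k) := by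
      filter_upwards [isOpen_slitPlane.mem_nhds hz] with y hy using ih y hy
    have := (hasDerivAt_id z).cpow_const (c := w - k) hz
    rw [iteratedDeriv_succ, hev.deriv_eq, deriv_const_mul_field]
    simp only [id] at this
    rw [this.deriv, Finset.prod_range_succ]
    push_cast
    rw [← sub_sub]
    ring

/-- The derivative of order `k` is a polynomial in `w` times `q ^ w`. For real `q > 0` the latter is
bounded on the strip; for non-real `q` it would grow exponentially with the imaginary part of `w`,
hence the restriction to positive reals. -/
theorem hasDerivsIn_cpow : HasDerivsIn (Subalgebra.toSubmodule (stripAlgebra univ))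
    fun q w => q ^ w := by
  refine ⟨fun w q hq => ?_, fun q hq k => ?_⟩
  · exact (differentiableAt_id.cpow_const hq).differentiableWithinAt
  · rw [Subalgebra.mem_toSubmodule]
    have h1 : (∏ i ∈ Finset.range k, ((fun w : ℂ => w) - algebraMap ℂ (ℂ → ℂ) i)) ∈ stripAlgebra univ :=
      (stripAlgebra univ).prod_mem fun i _ =>
        (stripAlgebra univ).sub_mem (id_mem_stripAlgebra _) ((stripAlgebra univ).algebraMap_mem _)
    have h2 := (stripAlgebra univ).smul_mem (ofReal_cpow_mem_stripAlgebra hq) ((q : ℂ) ^ (-(k : ℂ)))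
    convert (stripAlgebra univ).mul_mem h1 h2 using 1
    ext w
    have hq' : (q : ℂ) ≠ 0 := ofReal_ne_zero.2 hq.ne'
    rw [iteratedDeriv_cpow_const w k _ (ofReal_mem_slitPlane.2 hq), sub_eq_add_neg, cpow_add _ _ hq']
    simp only [Pi.mul_apply, Finset.prod_apply, Pi.sub_apply, Pi.algebraMap_apply,
      Algebra.algebraMap_self, RingHom.id_apply, Pi.smul_apply, smul_eq_mul]
    ring

theorem hasDerivsIn_gAux (l : List {x : ℝ // 0 < x}) :
    HasDerivsIn (Subalgebra.toSubmodule (stripAlgebra univ))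
      (gAux (l.map fun x : {x : ℝ // 0 < x} => ((x : ℝ) : ℂ))) := by
  induction l with
  | nil =>
    have := hasDerivsIn_cpow.dslope one_pos
    simp only [ofReal_one, one_mul, ← gAux_nil] at this
    exact this
  | cons p l ih =>
    have := ih.dslope p.2
    simpa only [List.map_cons, ← gAux_cons] using this

/-- Linearity of the divided difference. The identity is required on a neighbourhood of `a` so that
it can be differentiated there. -/
theorem dslope_eq_add_const_mul {f g h : ℂ → ℂ} {s : Set ℂ} (hs : IsOpen s) {a : ℂ} (ha : a ∈ s)
    (hg : DifferentiableAt ℂ g a) (hh : DifferentiableAt ℂ h a) (c : ℂ)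
    (hf : ∀ z ∈ s, f z = g z + c * h z) :
    ∀ z ∈ s, dslope f a z = dslope g a z + c * dslope h a z := by
  intro z hz
  rcases eq_or_ne z a with rfl | hza
  · have hev : f =ᶠ[nhds z] fun z => g z + c * h z := by
      filter_upwards [hs.mem_nhds hz] with y hy using hf y hy
    rw [dslope_same, dslope_same, dslope_same, hev.deriv_eq, deriv_fun_add hg (by fun_prop),
      deriv_const_mul _ hh]
  · rw [dslope_of_ne _ hza, dslope_of_ne _ hza, dslope_of_ne _ hza, slope_def_field,
      slope_def_field, slope_def_field, hf z hz, hf a ha]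
    ring

theorem gAux_nil_add_one {q : ℂ} (hq : q ∈ slitPlane) (w : ℂ) :
    gAux [] q (w + 1) = gAux [] q w + q ^ w := by
  have hq0 : q ≠ 0 := slitPlane_ne_zero hq
  rw [gAux, gAux]
  split_ifs with h
  · simp [h]
  · have : (1 : ℂ) - q ≠ 0 := sub_ne_zero.2 (Ne.symm h)
    rw [cpow_add _ _ hq0, cpow_one]
    field_simp
    ring

/-- The recursion for `G` works at the last entry, the difference equation at the first; since lists
are reversed here, `a` is the first entry. The base case is `(a z) ^ w = a ^ w * z ^ w`. Each
further entry applies a divided difference in the last variable, in which `a ^ w` is constant; this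
needs the equation for all `q` in the slit plane. -/
theorem gAux_append_add_one (l : List {x : ℝ // 0 < x}) (a : {x : ℝ // 0 < x}) (w : ℂ) :
    ∀ q ∈ slitPlane,
    gAux ((l ++ [a]).map fun x : {x : ℝ // 0 < x} => ((x : ℝ) : ℂ)) q (w + 1)
      = gAux ((l ++ [a]).map fun x : {x : ℝ // 0 < x} => ((x : ℝ) : ℂ)) q w
        + ((a : ℝ) : ℂ) ^ w * gAux (l.map fun x : {x : ℝ // 0 < x} => ((x : ℝ) : ℂ)) q w := by
  have hda : ∀ (l : List {x : ℝ // 0 < x}) (p : {x : ℝ // 0 < x}), DifferentiableAt ℂ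
      (fun z => gAux (l.map fun x : {x : ℝ // 0 < x} => ((x : ℝ) : ℂ)) (((p : ℝ) : ℂ) * z) w) 1 := by
    intro l p
    have h1 := ((hasDerivsIn_gAux l).1 w).differentiableAt (isOpen_slitPlane.mem_nhds
      (ofReal_mul_mem_slitPlane p.2 one_mem_slitPlane))
    exact h1.comp (1 : ℂ) (by fun_prop : DifferentiableAt ℂ (fun z : ℂ => ((p : ℝ) : ℂ) * z) 1)
  induction l with
  | nil =>
    intro q hq
    simp only [List.nil_append, List.map_cons, List.map_nil, gAux_cons]
    rw [gAux_nil q w]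
    refine dslope_eq_add_const_mul isOpen_slitPlane one_mem_slitPlane (hda [] a)
      (differentiableAt_fun_id.cpow_const one_mem_slitPlane) _ ?_ q hq
    intro z hz
    rw [List.map_nil, gAux_nil_add_one (ofReal_mul_mem_slitPlane a.2 hz), ofReal_mul_cpow a.2]
  | cons p l ih =>
    intro q hq
    simp only [List.cons_append, List.map_cons, gAux_cons]
    exact dslope_eq_add_const_mul isOpen_slitPlane one_mem_slitPlane (hda _ p) (hda _ p) _
      (fun z hz => ih _ (ofReal_mul_mem_slitPlane p.2 hz)) q hq

theorem G_nil (w : ℂ) : G [] w = 1 := rfl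

theorem G_append_singleton (l : List ℂ) (a w : ℂ) : G (l ++ [a]) w = gAux l.reverse a w := by
  simp [G]

theorem G_harmonic (w : ℂ) (p q : List {x : ℝ // 0 < x}) :
    G (p.map fun x : {x : ℝ // 0 < x} => ((x : ℝ) : ℂ)) w *
        G (q.map fun x : {x : ℝ // 0 < x} => ((x : ℝ) : ℂ)) w =
      gMap w (HarmonicAlgebra.tuple p * HarmonicAlgebra.tuple q) := by
  refine (HarmonicAlgebra.extend_tupleMul_apply isShiftDomain_univ
    (e := fun (a : {x : ℝ // 0 < x}) w => ((a : ℝ) : ℂ) ^ w)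
    (Φ := fun l w => G (l.map fun x : {x : ℝ // 0 < x} => ((x : ℝ) : ℂ)) w)
    ?_ ?_ ?_ ?_ ?_ p q w trivial).symm
  · intro a b w _
    simp only [Positive.val_mul, ofReal_mul]
    exact ofReal_mul_cpow a.2 _ _
  · intro w _
    exact G_nil w
  · intro l
    rcases List.eq_nil_or_concat l with rfl | ⟨l, a, rfl⟩
    · exact (stripAlgebra univ).one_mem
    · have : (fun w => _) ∈ stripAlgebra univ := (hasDerivsIn_gAux l.reverse).apply_mem a.2
      simpa only [List.concat_eq_append, List.map_append, List.map_cons, List.map_nil,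
        G_append_singleton, ← List.map_reverse] using this
  · intro a l
    obtain ⟨l', b, h⟩ : ∃ l' b, a :: l = l' ++ [b] :=
      ⟨_, _, (List.dropLast_append_getLast (List.cons_ne_nil a l)).symm⟩
    simp only [h, List.map_append, List.map_cons, List.map_nil, G_append_singleton, gAux_apply_zero]
  · intro a l w _
    rcases List.eq_nil_or_concat l with rfl | ⟨l, b, rfl⟩
    · have := gAux_nil_add_one (ofReal_mem_slitPlane.2 a.2) w
      simpa [G] using this
    · have := gAux_append_add_one l.reverse a w b (ofReal_mem_slitPlane.2 b.2)
      have e : (a :: l.concat b) = (a :: l) ++ [b] := by simp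
      rw [e]
      simpa only [List.concat_eq_append, List.map_append, List.map_cons, List.map_nil,
        G_append_singleton, ← List.map_reverse, List.reverse_cons] using this

end

/-! ### Newton interpolation and its remainder -/

/-- The binomial coefficient `w` over `k` as a polynomial function of `w`. -/
def complexChoose : ℕ → ℂ → ℂ
  | 0, _ => 1
  | k + 1, w => complexChoose k w * (w - k) / (k + 1)

theorem complexChoose_zero (w : ℂ) : complexChoose 0 w = 1 := rfl

theorem complexChoose_succ (k : ℕ) (w : ℂ) :
    complexChoose (k + 1) w = complexChoose k w * (w - k) / (k + 1) := rfl

theorem complexChoose_succ_zero (k : ℕ) : complexChoose (k + 1) 0 = 0 := by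
  induction k with
  | zero => simp [complexChoose_succ]
  | succ k ih => rw [complexChoose_succ, ih]; simp

theorem complexChoose_succ_add_one (k : ℕ) (w : ℂ) :
    complexChoose (k + 1) (w + 1) = complexChoose (k + 1) w + complexChoose k w := by
  induction k with
  | zero => simp [complexChoose_succ, complexChoose_zero]
  | succ k ih =>
    have h1 : (k + 1 : ℂ) ≠ 0 := Nat.cast_add_one_ne_zero k
    have h2 : (k + 1 + 1 : ℂ) ≠ 0 := by
      have := Nat.cast_add_one_ne_zero (R := ℂ) (k + 1)
      rwa [Nat.cast_succ] at this
    rw [complexChoose_succ (k + 1) (w + 1), ih, complexChoose_succ (k + 1) w, complexChoose_succ k w]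
    push_cast
    field_simp
    ring

theorem complexChoose_natCast (k : ℕ) : ∀ n : ℕ, complexChoose k n = n.choose k := by
  induction k with
  | zero => simp [complexChoose_zero]
  | succ k ih =>
    intro n
    induction n with
    | zero => simp [complexChoose_succ_zero]
    | succ n ihn =>
      rw [Nat.cast_succ, complexChoose_succ_add_one, ihn, ih, Nat.choose_succ_succ]
      push_cast
      ring

theorem differentiable_complexChoose (k : ℕ) : Differentiable ℂ (complexChoose k) := by
  induction k with
  | zero => exact differentiable_const 1
  | succ k ih =>
    change Differentiable ℂ fun w => complexChoose k w * (w - k) / (k + 1)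
    fun_prop

theorem norm_complexChoose_le (k : ℕ) (w : ℂ) : ‖complexChoose k w‖ ≤ (‖w‖ + k) ^ k := by
  induction k with
  | zero => simp [complexChoose_zero]
  | succ k ih =>
    have h1 : ‖(k + 1 : ℂ)‖ = k + 1 := by
      rw [← Nat.cast_succ, Complex.norm_natCast, Nat.cast_succ]
    have h2 : ‖w - k‖ ≤ ‖w‖ + k := by
      refine (norm_sub_le _ _).trans_eq ?_
      rw [Complex.norm_natCast]
    rw [complexChoose_succ, norm_div, norm_mul, h1, div_le_iff₀ (by positivity)]
    calc ‖complexChoose k w‖ * ‖w - k‖ ≤ (‖w‖ + k) ^ k * (‖w‖ + k) := by gcongr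
      _ = (‖w‖ + k) ^ (k + 1) * 1 := by ring
      _ ≤ (‖w‖ + (k + 1 : ℕ)) ^ (k + 1) * (k + 1) := by
        push_cast
        gcongr <;> linarith [(Nat.cast_nonneg k : (0 : ℝ) ≤ k)]

theorem norm_complexChoose_le_of_le {k n : ℕ} (hk : k ≤ n) (w : ℂ) :
    ‖complexChoose k w‖ ≤ ((n + 1) * (1 + ‖w‖)) ^ n := by
  have hk' : (k : ℝ) ≤ n := Nat.cast_le.2 hk
  have hw := norm_nonneg w
  have hn : (0 : ℝ) ≤ n := Nat.cast_nonneg n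
  have h1 : 1 ≤ (n + 1) * (1 + ‖w‖) := by nlinarith
  calc ‖complexChoose k w‖ ≤ (‖w‖ + k) ^ k := norm_complexChoose_le k w
    _ ≤ ((n + 1) * (1 + ‖w‖)) ^ k := by gcongr; nlinarith
    _ ≤ _ := pow_le_pow_right₀ h1 hk

/-- The difference of the Newton interpolation polynomial of `f` at `a, a + 1, …, a + n - 1` and
`f`, at `a + w`. -/
def newtonRem (n : ℕ) (f : ℂ → ℂ) (a w : ℂ) : ℂ :=
  (∑ k ∈ Finset.range n, complexChoose k w * (fwdDiff 1)^[k] f a) - f (a + w)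

/-- By the Gregory–Newton formula interpolation is exact at the nodes: at `w = i` the terms with `k
> i` vanish. -/
theorem newtonRem_natCast {n i : ℕ} (hi : i < n) (f : ℂ → ℂ) (a : ℂ) : newtonRem n f a i = 0 := by
  have h := shift_eq_sum_fwdDiff_iter (1 : ℂ) f i a
  rw [nsmul_one] at h
  rw [newtonRem, h, sub_eq_zero]
  symm
  refine (Finset.sum_subset (Finset.range_mono (Nat.succ_le_of_lt hi)) ?_).trans ?_
  · intro k _ hk
    rw [Finset.mem_range, not_lt] at hk
    rw [Nat.choose_eq_zero_of_lt (by omega), zero_smul]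
  · refine Finset.sum_congr rfl fun k _ => ?_
    rw [complexChoose_natCast, nsmul_eq_mul]

/-- By the Schwarz lemma on discs of radius `ρ`, one difference multiplies the bound by `2 / ρ` and
costs `ρ` of the radius. -/
theorem norm_fwdDiff_iter_le {ρ : ℝ} (hρ : 1 < ρ) (k : ℕ) : ∀ {f : ℂ → ℂ} {a : ℂ} {M : ℝ},
    DifferentiableOn ℂ f (ball a ((k + 1) * ρ)) → (∀ z ∈ ball a ((k + 1) * ρ), ‖f z‖ ≤ M) →
    ‖(fwdDiff 1)^[k] f a‖ ≤ M * (2 / ρ) ^ k := by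
  induction k with
  | zero =>
    intro f a M _ hM
    simpa using hM a (mem_ball_self (by simp; linarith))
  | succ k ih =>
    intro f a M hf hM
    rw [Function.iterate_succ_apply]
    have hsub : ∀ z ∈ ball a ((k + 1) * ρ), ball z ρ ⊆ ball a (((k + 1 : ℕ) + 1) * ρ) := by
      intro z hz
      refine ball_subset_ball' ?_
      rw [mem_ball] at hz
      push_cast
      linarith
    have h1 : ∀ z : ℂ, z + 1 ∈ ball z ρ := fun z => by simpa [dist_eq_norm] using hρ
    have := @ih (fwdDiff 1 f) a (M * (2 / ρ)) ?_ ?_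
    · rwa [mul_assoc, ← pow_succ'] at this
    · refine DifferentiableOn.sub ?_ ?_
      · exact hf.comp (by fun_prop) fun z hz => hsub z hz (h1 z)
      · exact hf.mono fun z hz => hsub z hz (mem_ball_self (by linarith))
    · intro z hz
      have hz0 := hM z (hsub z hz (mem_ball_self (by linarith)))
      have := Complex.dist_le_div_mul_dist_of_mapsTo_ball (R₂ := 2 * M) (hf.mono (hsub z hz))
        (fun y hy => by
          rw [mem_closedBall, dist_eq_norm]
          refine (norm_sub_le _ _).trans ?_
          linarith [hM y (hsub z hz hy)]) (h1 z)
      rw [dist_eq_norm, dist_eq_norm, add_sub_cancel_left, norm_one] at this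
      refine this.trans (le_of_eq ?_)
      ring

/-- A Schwarz lemma for functions with zeros at `0, 1, …, n - 1`. -/
theorem norm_le_of_apply_natCast_eq_zero (n : ℕ) : ∀ {g : ℂ → ℂ} {a : ℂ} {R M : ℝ} {w : ℂ},
    DifferentiableOn ℂ g (ball a R) → (∀ z ∈ ball a R, ‖g z‖ ≤ M) →
    (∀ i : ℕ, i < n → g (a + i) = 0) → ‖w - a‖ + 2 * n < R →
    ‖g w‖ ≤ M * ∏ i ∈ Finset.range n, (‖w - (a + i)‖ / (R - i)) := by
  induction n with
  | zero =>
    intro g a R M w hg hM _ hw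
    simpa using hM w (by simpa [dist_eq_norm] using hw)
  | succ n ih =>
    intro g a R M w hg hM h0 hw
    push_cast at hw
    have hn : (0 : ℝ) ≤ n := Nat.cast_nonneg n
    have hR : 0 < R := by linarith [norm_nonneg (w - a)]
    have hga : g a = 0 := by simpa using h0 0 (Nat.succ_pos n)
    -- Dividing out the zero at `a` improves the bound by the factor `1 / R`, by the Schwarz lemma.
    have hb : ∀ z ∈ ball a R, ‖dslope g a z‖ ≤ M / R := fun z hz =>
      Complex.norm_dslope_le_div_of_mapsTo_ball hg (fun y hy => by
        rw [hga]; simpa using hM y hy) hz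
    have hsub : ball (a + 1) (R - 1) ⊆ ball a R := ball_subset_ball' (by simp [dist_eq_norm])
    have hgd : DifferentiableOn ℂ (dslope g a) (ball a R) :=
      (Complex.differentiableOn_dslope (ball_mem_nhds a hR)).2 hg
    have := @ih (dslope g a) (a + 1) (R - 1) (M / R) w (hgd.mono hsub)
      (fun z hz => hb z (hsub hz)) ?_ ?_
    · have e : g w = (w - a) * dslope g a w := by
        have := sub_smul_dslope g a w
        rw [hga, sub_zero, smul_eq_mul] at this
        exact this.symm
      rw [e, norm_mul, Finset.prod_range_succ']
      refine (mul_le_mul_of_nonneg_left this (norm_nonneg _)).trans (le_of_eq ?_)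
      have : ∀ i ∈ Finset.range n, ‖w - (a + 1 + i)‖ / (R - 1 - i)
          = ‖w - (a + (i + 1 : ℕ))‖ / (R - (i + 1 : ℕ)) := by
        intro i _
        rw [Nat.cast_succ, Nat.cast_succ, add_comm (i : ℂ), add_comm (i : ℝ), add_assoc, sub_sub]
      rw [Finset.prod_congr rfl this]
      simp
      ring
    · intro i hi
      have hne : a + 1 + i ≠ a := by
        rw [add_assoc, Ne, add_eq_left]
        exact_mod_cast (by omega : 1 + i ≠ 0)
      rw [dslope_of_ne _ hne, slope_def_field, hga]
      have := h0 (i + 1) (by omega)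
      push_cast at this
      rw [add_assoc, add_comm (1 : ℂ), this]
      simp
    -- Each division costs one unit of radius and may move the centre one unit away from `w`, hence
    -- the margin `2 * n`.
    · have : ‖w - (a + 1)‖ ≤ ‖w - a‖ + 1 := by
        rw [← sub_sub]
        exact (norm_sub_le _ _).trans_eq (by simp)
      linarith

theorem DifferentiableOn.newtonRem {f : ℂ → ℂ} {a : ℂ} {R : ℝ} (hf : DifferentiableOn ℂ f (ball a R))
    (n : ℕ) : DifferentiableOn ℂ (newtonRem n f a) (ball 0 R) := by
  refine DifferentiableOn.sub ?_ ?_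
  · exact DifferentiableOn.fun_sum fun k _ =>
      (differentiable_complexChoose k).differentiableOn.mul_const _
  · exact hf.comp (by fun_prop) fun z hz => by simpa [dist_eq_norm] using hz

/-- The error of Newton interpolation for a bounded holomorphic function on a large disc. -/
theorem exists_norm_newtonRem_le (n : ℕ) : ∃ C : ℝ, 0 ≤ C ∧ ∀ {f : ℂ → ℂ} {a w : ℂ} {R M : ℝ},
    DifferentiableOn ℂ f (ball a R) → (∀ z ∈ ball a R, ‖f z‖ ≤ M) → ‖w‖ + 2 * (n + 1) < R →
    ‖newtonRem n f a w‖ ≤ C * M * ((1 + ‖w‖) / R) ^ n := by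
  refine ⟨(∑ k ∈ Finset.range n, (4 * (n + 1 : ℝ)) ^ k + 1) * (2 * (n + 1)) ^ n, by positivity, ?_⟩
  intro f a w R M hf hM hw
  have hn : (0 : ℝ) ≤ n := Nat.cast_nonneg n
  have hw0 := norm_nonneg w
  have hR : 2 * (n + 1) < R := by linarith
  have hR0 : 0 < R := by linarith
  have hM0 : 0 ≤ M := (norm_nonneg _).trans (hM a (mem_ball_self hR0))
  -- With `ρ = R / (n + 1)` the differences of order `k < n` only use values of `f` in the disc of
  -- radius `R`.
  have hρ : 1 < R / (n + 1) := by
    rw [lt_div_iff₀ (by positivity)]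
    linarith
  have hΔ : ∀ k < n, ‖(fwdDiff 1)^[k] f a‖ ≤ M * (2 / (R / (n + 1))) ^ k := by
    intro k hk
    have hk' : (k : ℝ) ≤ n := Nat.cast_le.2 hk.le
    have hsub : ball a ((k + 1) * (R / (n + 1))) ⊆ ball a R := by
      refine ball_subset_ball ?_
      rw [mul_div_assoc', div_le_iff₀ (by positivity)]
      nlinarith
    exact norm_fwdDiff_iter_le hρ k (hf.mono hsub) fun z hz => hM z (hsub hz)
  -- On the disc the binomial polynomials are `O(R ^ k)` and the differences are `O(R ^ (-k))`. The
  -- powers of `R` cancel, so the remainder is bounded by a multiple of `M` independent of `R`.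
  have hbd : ∀ z ∈ ball (0 : ℂ) R,
      ‖newtonRem n f a z‖ ≤ (∑ k ∈ Finset.range n, (4 * (n + 1 : ℝ)) ^ k + 1) * M := by
    intro z hz
    have hz' : ‖z‖ < R := by simpa using hz
    rw [newtonRem, add_mul, one_mul, Finset.sum_mul]
    refine (norm_sub_le _ _).trans (add_le_add ?_ (hM _ (by simpa [dist_eq_norm] using hz)))
    refine (norm_sum_le _ _).trans (Finset.sum_le_sum fun k hk => ?_)
    rw [Finset.mem_range] at hk
    have hk' : (k : ℝ) ≤ n := Nat.cast_le.2 hk.le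
    rw [norm_mul]
    calc ‖complexChoose k z‖ * ‖(fwdDiff 1)^[k] f a‖
        ≤ (2 * R) ^ k * (M * (2 / (R / (n + 1))) ^ k) := by
          refine mul_le_mul ((norm_complexChoose_le k z).trans ?_) (hΔ k hk) (norm_nonneg _)
            (by positivity)
          gcongr
          linarith
      _ = (2 * R * (2 / (R / (n + 1)))) ^ k * M := by rw [mul_pow (2 * R)]; ring
      _ = (4 * (n + 1)) ^ k * M := by
          have : 2 * R * (2 / (R / (n + 1))) = 4 * (n + 1) := by
            field_simp
            ring
          rw [this]
  have := norm_le_of_apply_natCast_eq_zero n (hf.newtonRem n) hbd (w := w)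
    (fun i hi => by rw [zero_add]; exact newtonRem_natCast hi f a) (by rw [sub_zero]; linarith)
  refine this.trans ?_
  have hp : ∏ i ∈ Finset.range n, (‖w - (0 + i)‖ / (R - i))
      ≤ ∏ _i ∈ Finset.range n, (2 * (n + 1) * ((1 + ‖w‖) / R)) := by
    refine Finset.prod_le_prod (fun i hi => ?_) fun i hi => ?_
    · rw [Finset.mem_range] at hi
      have hi' : (i : ℝ) ≤ n := Nat.cast_le.2 hi.le
      exact div_nonneg (norm_nonneg _) (by linarith)
    · rw [Finset.mem_range] at hi
      have hi' : (i : ℝ) ≤ n := Nat.cast_le.2 hi.le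
      have h1 : ‖w - (0 + i)‖ ≤ (n + 1) * (1 + ‖w‖) := by
        rw [zero_add]
        refine (norm_sub_le _ _).trans ?_
        rw [Complex.norm_natCast]
        nlinarith
      calc ‖w - (0 + i)‖ / (R - i) ≤ (n + 1) * (1 + ‖w‖) / (R / 2) := by
            gcongr
            linarith
        _ = _ := by field_simp
  rw [Finset.prod_const, Finset.card_range, mul_pow] at hp
  refine (mul_le_mul_of_nonneg_left hp (by positivity)).trans (le_of_eq ?_)
  ring

/-- A crude bound that gains no decay but, unlike the Schwarz estimate, needs no surrounding disc;
it also serves at `z = 0` and at small `j`. -/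
theorem norm_fwdDiff_iter_le_of_growth {B : ℕ} (k : ℕ) : ∀ {f : ℂ → ℂ} {C : ℝ},
    (∀ z : ℂ, 0 ≤ z.re → ‖f z‖ ≤ C * (1 + ‖z‖) ^ B) → ∀ z : ℂ, 0 ≤ z.re →
    ‖(fwdDiff 1)^[k] f z‖ ≤ (2 ^ (B + 1)) ^ k * C * (1 + ‖z‖) ^ B := by
  induction k with
  | zero => intro f C h z hz; simpa using h z hz
  | succ k ih =>
    intro f C h z hz
    have hC : 0 ≤ C := by
      have := (norm_nonneg _).trans (h 0 (by simp))
      simpa using this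
    have := @ih (fwdDiff 1 f) (2 ^ (B + 1) * C) (fun y hy => ?_) z hz
    · rw [Function.iterate_succ_apply]
      refine this.trans (le_of_eq ?_)
      ring
    · have h1 := h (y + 1) (by simp; linarith)
      have h2 := h y hy
      have h3 : ‖y + 1‖ ≤ ‖y‖ + 1 := (norm_add_le _ _).trans_eq (by simp)
      calc ‖f (y + 1) - f y‖ ≤ C * (1 + ‖y + 1‖) ^ B + C * (1 + ‖y‖) ^ B :=
            (norm_sub_le _ _).trans (add_le_add h1 h2)
        _ ≤ C * (2 * (1 + ‖y‖)) ^ B + C * (2 * (1 + ‖y‖)) ^ B := by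
            gcongr <;> linarith [norm_nonneg y]
        _ = _ := by rw [mul_pow]; ring

/-- `‖f w‖ ≤ C (1 + ‖w‖) ^ B` for `Re w ≥ 0`. -/
def HasGrowth (f : ℂ → ℂ) (C : ℝ) (B : ℕ) : Prop :=
  ∀ w : ℂ, 0 ≤ w.re → ‖f w‖ ≤ C * (1 + ‖w‖) ^ B

theorem HasGrowth.nonneg {f : ℂ → ℂ} {C : ℝ} {B : ℕ} (h : HasGrowth f C B) : 0 ≤ C := by
  have := (norm_nonneg _).trans (h 0 (by simp))
  simpa using this

/-- The disc of radius `j` about `j` lies in the right half plane, where `f` is `O(j ^ B)`. Of the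
`B + m` nodes, `B` compensate this growth and `m` give decay. Later `m = 2` yields summability and
`m = 1` a vanishing boundary term. -/
theorem exists_norm_newtonRem_le_of_norm_lt (B m : ℕ) : ∃ K : ℝ, 0 ≤ K ∧ ∀ {f : ℂ → ℂ} {C : ℝ},
    DifferentiableOn ℂ f {w | 0 < w.re} → HasGrowth f C B → ∀ (j : ℕ) (w : ℂ),
    ‖w‖ + 2 * ((B + m : ℕ) + 1) < j →
    ‖newtonRem (B + m) f j w‖ ≤ K * C * (1 + ‖w‖) ^ (B + m) / (1 + j) ^ m := by
  obtain ⟨K, hK, h⟩ := exists_norm_newtonRem_le (B + m)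
  refine ⟨K * 2 ^ B * 2 ^ (B + m), by positivity, ?_⟩
  intro f C hf hg j w hw
  have hC := hg.nonneg
  have hB : (0 : ℝ) ≤ (B + m : ℕ) := Nat.cast_nonneg _
  have hj : (1 : ℝ) ≤ j := by linarith [norm_nonneg w]
  have hre : ∀ z ∈ ball (j : ℂ) (j : ℝ), 0 < z.re := by
    intro z hz
    have h1 : |(z - j).re| < j :=
      (Complex.abs_re_le_norm _).trans_lt (by simpa [dist_eq_norm] using hz)
    have := (abs_lt.1 h1).1
    simp only [Complex.sub_re, Complex.natCast_re] at this
    linarith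
  have := h (hf.mono hre) (M := C * 2 ^ B * (1 + j) ^ B) (fun z hz => by
    refine (hg z (hre z hz).le).trans ?_
    have h1 : ‖z‖ ≤ j + j := by
      have : ‖z - j‖ < j := by simpa [dist_eq_norm] using hz
      calc ‖z‖ = ‖(j : ℂ) + (z - j)‖ := by ring_nf
        _ ≤ _ := (norm_add_le _ _).trans (by rw [Complex.norm_natCast]; linarith)
    rw [mul_assoc, ← mul_pow]
    gcongr
    linarith) hw
  refine this.trans ?_
  have h2 : (1 + ‖w‖) / j ≤ 2 * ((1 + ‖w‖) / (1 + j)) := by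
    rw [mul_div_assoc', div_le_div_iff₀ (by linarith) (by linarith)]
    nlinarith [norm_nonneg w]
  calc K * (C * 2 ^ B * (1 + j) ^ B) * ((1 + ‖w‖) / j) ^ (B + m)
      ≤ K * (C * 2 ^ B * (1 + j) ^ B) * (2 * ((1 + ‖w‖) / (1 + j))) ^ (B + m) := by gcongr
    _ = _ := by
      rw [mul_pow, div_pow, pow_add (1 + (j : ℝ)) B m]
      field_simp

/-- A bound for all `j` at once, needed to make the sum over `j` grow polynomially in `w`. Large `j`
are covered by the previous estimate; for the others `1 + j = O(1 + ‖w‖)`. -/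
theorem exists_norm_newtonRem_le_of_re_nonneg (B : ℕ) : ∃ K : ℝ, 0 ≤ K ∧ ∀ {f : ℂ → ℂ} {C : ℝ},
    DifferentiableOn ℂ f {w | 0 < w.re} → HasGrowth f C B → ∀ (j : ℕ) (w : ℂ), 0 ≤ w.re →
    ‖newtonRem (B + 2) f j w‖ ≤ K * C * (1 + ‖w‖) ^ (2 * (B + 2)) / (1 + j) ^ 2 := by
  obtain ⟨K, hK, h⟩ := exists_norm_newtonRem_le_of_norm_lt B 2
  obtain ⟨n, hn⟩ : ∃ n, n = B + 2 := ⟨_, rfl⟩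
  let K' : ℝ := (n * ((n + 1) ^ n * (2 ^ (B + 1)) ^ n) + 1) * (2 * n + 3) ^ n
  refine ⟨K + K', by positivity, ?_⟩
  intro f C hf hg j w hw
  rw [← hn] at h ⊢
  have hC := hg.nonneg
  have hw0 := norm_nonneg w
  have hx1 : 1 ≤ 1 + ‖w‖ := by linarith
  have hj0 : (0 : ℝ) ≤ j := Nat.cast_nonneg j
  have hn0 : (0 : ℝ) ≤ n := Nat.cast_nonneg n
  rcases lt_or_ge (‖w‖ + 2 * ((n : ℝ) + 1)) j with hlt | hge
  · refine (h hf hg j w (by exact_mod_cast hlt)).trans ?_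
    have : 0 ≤ K' := by positivity
    gcongr
    · linarith
    · omega
  · have hy : 1 + (j : ℝ) ≤ (2 * n + 3) * (1 + ‖w‖) := by nlinarith
    have h1 : ‖∑ k ∈ Finset.range n, complexChoose k w * (fwdDiff 1)^[k] f (j : ℂ)‖
        ≤ n * ((n + 1) ^ n * (2 ^ (B + 1)) ^ n) * (C * (1 + ‖w‖) ^ n * (1 + j) ^ B) := by
      refine (norm_sum_le _ _).trans ((Finset.sum_le_card_nsmul _ _
        (((n + 1) ^ n * (2 ^ (B + 1)) ^ n) * (C * (1 + ‖w‖) ^ n * (1 + j) ^ B)) ?_).trans_eq ?_)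
      · intro k hk
        rw [Finset.mem_range] at hk
        rw [norm_mul]
        have e2 := norm_fwdDiff_iter_le_of_growth k hg (j : ℂ) (by simp)
        rw [Complex.norm_natCast] at e2
        calc ‖complexChoose k w‖ * ‖(fwdDiff 1)^[k] f (j : ℂ)‖
            ≤ ((n + 1) * (1 + ‖w‖)) ^ n * ((2 ^ (B + 1)) ^ n * C * (1 + j) ^ B) := by
              refine mul_le_mul (norm_complexChoose_le_of_le hk.le w) (e2.trans ?_) (norm_nonneg _)
                (by positivity)
              gcongr
              exact one_le_pow₀ (by norm_num)
          _ = _ := by rw [mul_pow]; ring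
      · rw [Finset.card_range, nsmul_eq_mul]
        ring
    have h2 : ‖f (j + w)‖ ≤ C * (1 + ‖w‖) ^ n * (1 + j) ^ B := by
      refine (hg (j + w) (by simp; linarith)).trans ?_
      have e1 : ‖(j : ℂ) + w‖ ≤ j + ‖w‖ := (norm_add_le _ _).trans_eq (by rw [Complex.norm_natCast])
      calc C * (1 + ‖(j : ℂ) + w‖) ^ B ≤ C * ((1 + ‖w‖) * (1 + j)) ^ B := by
            gcongr
            nlinarith
        _ = C * (1 + ‖w‖) ^ B * (1 + j) ^ B := by rw [mul_pow]; ring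
        _ ≤ _ := by
            gcongr
            omega
    -- Here `j` is small relative to `w`, so the missing decay `(1 + j) ^ (-2)` is bought with
    -- powers of `1 + ‖w‖`; this doubles the exponent.
    have h3 : (1 + (j : ℝ)) ^ B ≤ (2 * n + 3) ^ n * (1 + ‖w‖) ^ n / (1 + j) ^ 2 := by
      rw [le_div_iff₀ (by positivity), ← pow_add, ← hn, ← mul_pow]
      gcongr
    calc ‖newtonRem n f j w‖
        ≤ n * ((n + 1) ^ n * (2 ^ (B + 1)) ^ n) * (C * (1 + ‖w‖) ^ n * (1 + j) ^ B)
          + C * (1 + ‖w‖) ^ n * (1 + j) ^ B := (norm_sub_le _ _).trans (add_le_add h1 h2)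
      _ = (n * ((n + 1) ^ n * (2 ^ (B + 1)) ^ n) + 1) * (C * (1 + ‖w‖) ^ n) * (1 + j) ^ B := by ring
      _ ≤ (n * ((n + 1) ^ n * (2 ^ (B + 1)) ^ n) + 1) * (C * (1 + ‖w‖) ^ n)
          * ((2 * n + 3) ^ n * (1 + ‖w‖) ^ n / (1 + j) ^ 2) := by gcongr
      _ = K' * C * (1 + ‖w‖) ^ (2 * n) / (1 + j) ^ 2 := by
          rw [two_mul n, pow_add]
          ring
      _ ≤ _ := by
          gcongr
          linarith

/-! ### Holomorphic series and regularized indefinite sums -/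

/-- Cauchy's estimate on balls of half the radius turns bounds on the terms into bounds on their
derivatives, so the series may be differentiated termwise. A general space `E` gives joint
holomorphy in the parameters and `w`. -/
theorem differentiableAt_tsum_of_norm_le {E : Type*} [NormedAddCommGroup E] [NormedSpace ℂ E]
    {F : ℕ → E → ℂ} {x : E} {r : ℝ} (hr : 0 < r) {u : ℕ → ℝ} (hu : Summable u)
    (hF : ∀ n, DifferentiableOn ℂ (F n) (ball x r)) (hb : ∀ n, ∀ y ∈ ball x r, ‖F n y‖ ≤ u n) :
    DifferentiableAt ℂ (fun y => ∑' n, F n y) x := by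
  have hsub : ∀ y ∈ ball x (r / 2), ball y (r / 2) ⊆ ball x r := fun y hy =>
    ball_subset_ball' (by rw [mem_ball] at hy; linarith)
  have hxm : x ∈ ball x (r / 2) := mem_ball_self (by linarith)
  refine (hasFDerivAt_tsum_of_isPreconnected (𝕜 := ℂ) (f' := fun n y => fderiv ℂ (F n) y)
    (hu.mul_left (2 / (r / 2))) isOpen_ball
    (convex_ball x (r / 2)).isPreconnected ?_ ?_ hxm
    (Summable.of_norm_bounded hu fun n => hb n x (mem_ball_self hr)) hxm).differentiableAt
  · intro n y hy
    exact ((hF n).differentiableAt (isOpen_ball.mem_nhds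
      (hsub y hy (mem_ball_self (by linarith))))).hasFDerivAt
  · intro n y hy
    have hy0 := hb n y (hsub y hy (mem_ball_self (by linarith)))
    refine (Complex.norm_fderiv_le_div_of_mapsTo_ball (R₂ := 2 * u n) ((hF n).mono (hsub y hy))
      (fun z hz => ?_) (by linarith)).trans (le_of_eq (by ring))
    rw [mem_closedBall, dist_eq_norm]
    refine (norm_sub_le _ _).trans ?_
    linarith [hb n z (hsub y hy hz)]

/-- A series of holomorphic functions that is eventually dominated by a convergent series is
holomorphic. -/
theorem differentiableAt_tsum_of_eventually_norm_le {E : Type*} [NormedAddCommGroup E]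
    [NormedSpace ℂ E] {F : ℕ → E → ℂ} {x : E} {r : ℝ} (hr : 0 < r) {u : ℕ → ℝ} (hu : Summable u)
    (J : ℕ) (hF : ∀ n, DifferentiableOn ℂ (F n) (ball x r))
    (hb : ∀ n ≥ J, ∀ y ∈ ball x r, ‖F n y‖ ≤ u n) :
    DifferentiableAt ℂ (fun y => ∑' n, F n y) x := by
  have h1 := differentiableAt_tsum_of_norm_le hr ((summable_nat_add_iff J).2 hu)
    (F := fun n => F (n + J)) (fun n => hF _) (fun n y hy => hb _ (by omega) y hy)
  have h2 : DifferentiableAt ℂ (fun y => ∑ n ∈ Finset.range J, F n y) x :=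
    DifferentiableAt.fun_sum fun n _ => (hF n).differentiableAt (ball_mem_nhds x hr)
  refine (h2.add h1).congr_of_eventuallyEq ?_
  filter_upwards [ball_mem_nhds x hr] with y hy
  have hs : Summable fun n => F n y := (summable_nat_add_iff J).1
    (Summable.of_norm_bounded ((summable_nat_add_iff J).2 hu) fun n => hb _ (by omega) y hy)
  exact (hs.sum_add_tsum_nat_add J).symm

/-- The indefinite sum of `f` that is obtained by regularizing the series `∑ (f j - f (j + w))`
with Newton interpolation polynomials of degree at most `n`. -/
def newtonSum (n : ℕ) (f : ℂ → ℂ) (w : ℂ) : ℂ :=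
  (∑' j : ℕ, newtonRem (n + 1) f j w)
    + ∑ k ∈ Finset.range n, complexChoose (k + 1) w * (fwdDiff 1)^[k] f 0

theorem newtonSum_zero (n : ℕ) (f : ℂ → ℂ) : newtonSum n f 0 = 0 := by
  have h : ∀ j : ℕ, newtonRem (n + 1) f j 0 = 0 := fun j => by
    have := newtonRem_natCast (Nat.succ_pos n) f (j : ℂ)
    simpa using this
  simp [newtonSum, h, complexChoose_succ_zero]

theorem summable_const_div_one_add_sq (c : ℝ) : Summable fun j : ℕ => c / (1 + (j : ℝ)) ^ 2 := by
  have h := (summable_nat_add_iff 1).2 (Real.summable_one_div_nat_pow.2 one_lt_two)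
  refine (h.mul_left c).congr fun j => ?_
  push_cast
  rw [mul_one_div, add_comm]

theorem HasGrowth.summable_newtonRem {f : ℂ → ℂ} {C : ℝ} {B : ℕ} (hg : HasGrowth f C B)
    (hf : DifferentiableOn ℂ f {w | 0 < w.re}) (w : ℂ) :
    Summable fun j : ℕ => newtonRem (B + 2) f j w := by
  obtain ⟨K, hK, h⟩ := exists_norm_newtonRem_le_of_norm_lt B 2
  obtain ⟨J, hJ⟩ := exists_nat_gt (‖w‖ + 2 * ((B + 2 : ℕ) + 1))
  refine (summable_nat_add_iff J).1 (Summable.of_norm_bounded ((summable_nat_add_iff J).2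
    (summable_const_div_one_add_sq (K * C * (1 + ‖w‖) ^ (B + 2)))) fun j => h hf hg (j + J) w ?_)
  push_cast at hJ ⊢
  linarith [(Nat.cast_nonneg j : (0 : ℝ) ≤ j)]

theorem HasGrowth.tendsto_newtonRem {f : ℂ → ℂ} {C : ℝ} {B : ℕ} (hg : HasGrowth f C B)
    (hf : DifferentiableOn ℂ f {w | 0 < w.re}) (w : ℂ) :
    Filter.Tendsto (fun j : ℕ => newtonRem (B + 1) f j w) Filter.atTop (nhds 0) := by
  obtain ⟨K, hK, h⟩ := exists_norm_newtonRem_le_of_norm_lt B 1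
  obtain ⟨J, hJ⟩ := exists_nat_gt (‖w‖ + 2 * ((B + 1 : ℕ) + 1))
  have ht := (tendsto_one_div_add_atTop_nhds_zero_nat (𝕜 := ℝ)).const_mul
    (K * C * (1 + ‖w‖) ^ (B + 1))
  rw [mul_zero] at ht
  refine squeeze_zero_norm' ?_ ht
  filter_upwards [Filter.eventually_ge_atTop J] with j hj
  have hj' : (J : ℝ) ≤ j := Nat.cast_le.2 hj
  refine (h hf hg j w (by linarith)).trans (le_of_eq ?_)
  rw [pow_one, mul_one_div, add_comm (1 : ℝ) j]

/-- Pascal's rule turns the increment in `w` into an increment in `a` of the remainder of lower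
degree, which makes the sum over `a = 0, 1, …` telescope. -/
theorem newtonRem_succ_add_one (n : ℕ) (f : ℂ → ℂ) (a w : ℂ) :
    newtonRem (n + 1) f a (w + 1) = newtonRem (n + 1) f a w
      + (newtonRem n f (a + 1) w - newtonRem n f a w) := by
  simp only [newtonRem]
  rw [Finset.sum_range_succ', Finset.sum_range_succ' _ n]
  have h : ∀ k ∈ Finset.range n, complexChoose (k + 1) (w + 1) * (fwdDiff 1)^[k + 1] f a
      = complexChoose (k + 1) w * (fwdDiff 1)^[k + 1] f a
        + (complexChoose k w * (fwdDiff 1)^[k] f (a + 1)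
          - complexChoose k w * (fwdDiff 1)^[k] f a) := by
    intro k _
    rw [complexChoose_succ_add_one, Function.iterate_succ_apply', fwdDiff]
    ring
  rw [Finset.sum_congr rfl h, Finset.sum_add_distrib, Finset.sum_sub_distrib,
    complexChoose_zero, complexChoose_zero, add_right_comm a 1 w, add_assoc a w 1]
  ring

theorem HasGrowth.newtonSum_add_one {f : ℂ → ℂ} {C : ℝ} {B : ℕ} (hg : HasGrowth f C B)
    (hf : DifferentiableOn ℂ f {w | 0 < w.re}) (w : ℂ) :
    newtonSum (B + 1) f (w + 1) = newtonSum (B + 1) f w + f w := by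
  have h1 := (hg.summable_newtonRem hf (w + 1)).hasSum.tendsto_sum_nat
  have h0 := (hg.summable_newtonRem hf w).hasSum.tendsto_sum_nat
  have hd : ∀ N : ℕ, (∑ j ∈ Finset.range N, newtonRem (B + 2) f j (w + 1))
      = (∑ j ∈ Finset.range N, newtonRem (B + 2) f j w)
        + (newtonRem (B + 1) f N w - newtonRem (B + 1) f 0 w) := by
    intro N
    induction N with
    | zero => simp
    | succ N ih =>
      rw [Finset.sum_range_succ, Finset.sum_range_succ, ih, newtonRem_succ_add_one]
      push_cast
      ring
  have h2 := h0.add ((hg.tendsto_newtonRem hf w).sub_const (newtonRem (B + 1) f 0 w))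
  -- The boundary term at infinity vanishes. The one at `j = 0` contributes `f w` minus a Newton
  -- polynomial, and the increment of the finite sum in `newtonSum` cancels that polynomial.
  have h3 := tendsto_nhds_unique h1 (h2.congr fun N => (hd N).symm)
  rw [newtonSum, newtonSum, h3]
  simp only [complexChoose_succ_add_one, add_mul, Finset.sum_add_distrib]
  rw [newtonRem]
  simp
  ring

/-- `K` and `A` depend on `B` only, so growth that is locally uniform in a parameter stays so. -/
theorem exists_hasGrowth_newtonSum (B : ℕ) : ∃ (K : ℝ) (A : ℕ), ∀ {f : ℂ → ℂ} {C : ℝ},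
    DifferentiableOn ℂ f {w | 0 < w.re} → HasGrowth f C B →
    HasGrowth (newtonSum (B + 1) f) (K * C) A := by
  obtain ⟨K, hK, h⟩ := exists_norm_newtonRem_le_of_re_nonneg B
  refine ⟨K * ∑' j : ℕ, 1 / (1 + (j : ℝ)) ^ 2
    + (B + 1) * ((B + 2) ^ (B + 1) * (2 ^ (B + 1)) ^ (B + 1)), 2 * (B + 2), ?_⟩
  intro f C hf hg w hw
  have hC := hg.nonneg
  have hw0 := norm_nonneg w
  have hx1 : 1 ≤ 1 + ‖w‖ := by linarith
  have h1 : ‖∑' j : ℕ, newtonRem (B + 2) f j w‖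
      ≤ K * C * (1 + ‖w‖) ^ (2 * (B + 2)) * ∑' j : ℕ, 1 / (1 + (j : ℝ)) ^ 2 := by
    refine tsum_of_norm_bounded ((summable_const_div_one_add_sq 1).hasSum.mul_left _) fun j => ?_
    rw [mul_one_div]
    exact h hf hg j w hw
  have h2 : ‖∑ k ∈ Finset.range (B + 1), complexChoose (k + 1) w * (fwdDiff 1)^[k] f 0‖
      ≤ (B + 1) * ((B + 2) ^ (B + 1) * (2 ^ (B + 1)) ^ (B + 1)) * C * (1 + ‖w‖) ^ (2 * (B + 2)) := by
    refine (norm_sum_le _ _).trans ((Finset.sum_le_card_nsmul _ _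
      (((B + 2) ^ (B + 1) * (2 ^ (B + 1)) ^ (B + 1)) * C * (1 + ‖w‖) ^ (2 * (B + 2))) ?_).trans_eq ?_)
    · intro k hk
      rw [Finset.mem_range] at hk
      rw [norm_mul]
      have e1 := norm_complexChoose_le_of_le (k := k + 1) (n := B + 1) (by omega) w
      have e2 := norm_fwdDiff_iter_le_of_growth k hg 0 (by simp)
      rw [norm_zero, add_zero, one_pow, mul_one] at e2
      have e3 : (((B + 1 : ℕ) : ℝ) + 1) = B + 2 := by push_cast; ring
      rw [e3] at e1
      calc ‖complexChoose (k + 1) w‖ * ‖(fwdDiff 1)^[k] f 0‖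
          ≤ ((B + 2) * (1 + ‖w‖)) ^ (B + 1) * ((2 ^ (B + 1)) ^ (B + 1) * C) := by
            refine mul_le_mul e1 (e2.trans ?_) (norm_nonneg _) (by positivity)
            gcongr
            exact one_le_pow₀ (by norm_num)
        _ = ((B + 2) ^ (B + 1) * (2 ^ (B + 1)) ^ (B + 1)) * C * (1 + ‖w‖) ^ (B + 1) := by
            rw [mul_pow]; ring
        _ ≤ _ := by
            gcongr
            omega
    · rw [Finset.card_range, nsmul_eq_mul]
      push_cast
      ring
  refine (norm_add_le _ _).trans ((add_le_add h1 h2).trans_eq ?_)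
  ring

/-! ### Holomorphy in parameters on `psiDomain` -/

theorem mem_psiDomain_iff {w : ℂ} : w ∈ psiDomain ↔ w + 1 ∈ Complex.slitPlane := by
  rw [Complex.mem_slitPlane_iff_not_le_zero]
  constructor
  · intro h hle
    rw [Complex.le_def] at hle
    simp only [Complex.add_re, Complex.one_re, Complex.zero_re, Complex.add_im, Complex.one_im,
      add_zero, Complex.zero_im] at hle
    exact h w.re (by linarith [hle.1]) (Complex.ext (by simp) (by simp [hle.2]))
  · rintro h x hx rfl
    refine h ?_
    rw [Complex.le_def]
    exact ⟨by simp; linarith, by simp⟩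

theorem isShiftDomain_psiDomain : IsShiftDomain psiDomain where
  isOpen := by
    have : psiDomain = (fun w : ℂ => w + 1) ⁻¹' Complex.slitPlane := by
      ext w
      exact mem_psiDomain_iff
    rw [this]
    exact Complex.isOpen_slitPlane.preimage (by fun_prop)
  mem_of_re := fun w hw => mem_psiDomain_iff.2 (Or.inl (by simp; linarith))
  add_one := fun w hw => by
    rw [mem_psiDomain_iff, Complex.mem_slitPlane_iff] at hw ⊢
    simp only [Complex.add_re, Complex.one_re, Complex.add_im, Complex.one_im, add_zero] at hw ⊢
    rcases hw with h | h
    · exact Or.inl (by linarith)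
    · exact Or.inr h

/-- `f (s, w)` is holomorphic and, locally uniformly in `s`, polynomially bounded for
`Re w ≥ 0`. -/
structure HasHolomorphicGrowth {E : Type*} [NormedAddCommGroup E] [NormedSpace ℂ E]
    (f : E × ℂ → ℂ) : Prop where
  differentiableOn : DifferentiableOn ℂ f (univ ×ˢ psiDomain)
  growth : ∀ s₀, ∃ U ∈ nhds s₀, ∃ C B, ∀ s ∈ U, HasGrowth (fun w => f (s, w)) C B

section Parameters

variable {E : Type*} [NormedAddCommGroup E] [NormedSpace ℂ E]

theorem DifferentiableOn.slice {f : E × ℂ → ℂ} (hf : DifferentiableOn ℂ f (univ ×ˢ psiDomain))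
    (s : E) : DifferentiableOn ℂ (fun w => f (s, w)) psiDomain :=
  hf.comp (by fun_prop) fun _ hw => ⟨trivial, hw⟩

theorem DifferentiableOn.slice_re_pos {f : E × ℂ → ℂ}
    (hf : DifferentiableOn ℂ f (univ ×ˢ psiDomain)) (s : E) :
    DifferentiableOn ℂ (fun w => f (s, w)) {w | 0 < w.re} :=
  (hf.slice s).mono fun w hw => isShiftDomain_psiDomain.mem_of_re w (by
    have h0 : 0 < w.re := hw
    linarith)

theorem DifferentiableOn.fwdDiff_iter (k : ℕ) : ∀ {f : E × ℂ → ℂ},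
    DifferentiableOn ℂ f (univ ×ˢ psiDomain) →
    DifferentiableOn ℂ (fun p : E × ℂ => (fwdDiff 1)^[k] (fun w => f (p.1, w)) p.2)
      (univ ×ˢ psiDomain) := by
  induction k with
  | zero => intro f hf; exact hf
  | succ k ih =>
    intro f hf
    have h1 : DifferentiableOn ℂ (fun p : E × ℂ => f (p.1, p.2 + 1) - f p) (univ ×ˢ psiDomain) :=
      (hf.comp (f := fun p : E × ℂ => (p.1, p.2 + 1)) (by fun_prop)
        fun p hp => ⟨trivial, isShiftDomain_psiDomain.add_one _ hp.2⟩).sub hf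
    exact ih h1

theorem natCast_mem_psiDomain (j : ℕ) : (j : ℂ) ∈ psiDomain :=
  isShiftDomain_psiDomain.mem_of_re _ (by
    rw [Complex.natCast_re]
    linarith [(Nat.cast_nonneg j : (0 : ℝ) ≤ j)])

theorem DifferentiableOn.fwdDiff_iter_natCast {f : E × ℂ → ℂ}
    (hf : DifferentiableOn ℂ f (univ ×ˢ psiDomain)) (k j : ℕ) :
    Differentiable ℂ fun p : E × ℂ => (fwdDiff 1)^[k] (fun w => f (p.1, w)) (j : ℂ) := by
  rw [← differentiableOn_univ]
  exact (DifferentiableOn.fwdDiff_iter k hf).comp (f := fun p : E × ℂ => (p.1, (j : ℂ)))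
    (by fun_prop) fun p _ => ⟨trivial, natCast_mem_psiDomain j⟩

theorem DifferentiableOn.newtonRem_prod {f : E × ℂ → ℂ}
    (hf : DifferentiableOn ℂ f (univ ×ˢ psiDomain)) (n j : ℕ) :
    DifferentiableOn ℂ (fun p : E × ℂ => _root_.newtonRem n (fun w => f (p.1, w)) j p.2)
      (univ ×ˢ psiDomain) := by
  refine DifferentiableOn.sub (DifferentiableOn.fun_sum fun k _ => ?_) ?_
  · exact (((differentiable_complexChoose k).comp differentiable_snd).mul
      (hf.fwdDiff_iter_natCast k j)).differentiableOn
  · refine hf.comp (f := fun p : E × ℂ => (p.1, (j : ℂ) + p.2)) (by fun_prop) fun p hp => ⟨trivial, ?_⟩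
    have := isShiftDomain_psiDomain.add_nat hp.2 j
    rwa [add_comm] at this

theorem differentiableAt_newtonSum_prod {f : E × ℂ → ℂ}
    (hf : DifferentiableOn ℂ f (univ ×ˢ psiDomain)) {s₀ : E} {U : Set E} (hU : U ∈ nhds s₀) {C : ℝ}
    {B : ℕ} (hg : ∀ s ∈ U, HasGrowth (fun w => f (s, w)) C B) {w₀ : ℂ} (hw₀ : w₀ ∈ psiDomain) :
    DifferentiableAt ℂ (fun p : E × ℂ => newtonSum (B + 1) (fun w => f (p.1, w)) p.2) (s₀, w₀) := by
  obtain ⟨K, hK, h⟩ := exists_norm_newtonRem_le_of_norm_lt B 2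
  have hC : 0 ≤ C := (hg s₀ (mem_of_mem_nhds hU)).nonneg
  have hN : (U ×ˢ (psiDomain ∩ ball w₀ 1)) ∈ nhds (s₀, w₀) :=
    prod_mem_nhds hU (Filter.inter_mem (isShiftDomain_psiDomain.isOpen.mem_nhds hw₀)
      (ball_mem_nhds w₀ one_pos))
  obtain ⟨r, hr, hball⟩ := Metric.mem_nhds_iff.1 hN
  -- Beyond `J` the decay estimate holds uniformly for `w` within distance `1` of `w₀`; the finitely
  -- many earlier terms only need to be holomorphic.
  obtain ⟨J, hJ⟩ := exists_nat_gt (‖w₀‖ + 1 + 2 * ((B + 2 : ℕ) + 1))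
  refine DifferentiableAt.add (differentiableAt_tsum_of_eventually_norm_le hr
    (summable_const_div_one_add_sq (K * C * (1 + (‖w₀‖ + 1)) ^ (B + 2))) J
    (fun n => (hf.newtonRem_prod _ n).mono fun p hp => ⟨trivial, (hball hp).2.1⟩) ?_)
    (DifferentiableAt.fun_sum fun k _ => ?_)
  · intro j hj p hp
    have hj' : (J : ℝ) ≤ j := Nat.cast_le.2 hj
    have hp2 : ‖p.2‖ ≤ ‖w₀‖ + 1 := by
      have h1 : ‖p.2 - w₀‖ < 1 := by simpa [dist_eq_norm] using (hball hp).2.2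
      calc ‖p.2‖ = ‖w₀ + (p.2 - w₀)‖ := by ring_nf
        _ ≤ _ := (norm_add_le _ _).trans (by linarith)
    refine (h (hf.slice_re_pos p.1) (hg p.1 (hball hp).1) j p.2 (by linarith)).trans ?_
    gcongr
  · have := hf.fwdDiff_iter_natCast k 0
    rw [Nat.cast_zero] at this
    exact (((differentiable_complexChoose (k + 1)).comp differentiable_snd).mul this).differentiableAt

end Parameters

/-! ### Normalized indefinite sums -/

/-- `h` is the normalized indefinite sum of `f`. -/
structure IsIndefSum (f h : ℂ → ℂ) : Prop where
  mem : h ∈ stripAlgebra psiDomain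
  apply_zero : h 0 = 0
  add_one : ∀ w ∈ psiDomain, h (w + 1) = h w + f w

theorem IsIndefSum.unique {f h h' : ℂ → ℂ} (hh : IsIndefSum f h) (hh' : IsIndefSum f h') :
    ∀ w ∈ psiDomain, h w = h' w := by
  have := isShiftDomain_psiDomain.eq_zero_of_periodic ((stripAlgebra _).sub_mem hh.mem hh'.mem) ?_ ?_
  · intro w hw
    exact sub_eq_zero.1 (this w hw)
  · intro w hw
    simp only [Pi.sub_apply, hh.add_one w hw, hh'.add_one w hw]
    ring
  · simp [hh.apply_zero, hh'.apply_zero]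

theorem HasGrowth.mem_stripAlgebra {f : ℂ → ℂ} {C : ℝ} {B : ℕ} (h : HasGrowth f C B)
    (hf : DifferentiableOn ℂ f psiDomain) : f ∈ stripAlgebra psiDomain :=
  ⟨hf, C, B, fun w hw _ => h w hw⟩

/-- The normalized indefinite sum of `f`. -/
def indefSum (f : ℂ → ℂ) : ℂ → ℂ := Classical.epsilon (IsIndefSum f)

theorem IsIndefSum.indefSum {f h : ℂ → ℂ} (hh : IsIndefSum f h) : IsIndefSum f (indefSum f) :=
  Classical.epsilon_spec ⟨h, hh⟩

theorem IsIndefSum.eq_indefSum {f h : ℂ → ℂ} (hh : IsIndefSum f h) {w : ℂ} (hw : w ∈ psiDomain) :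
    h w = _root_.indefSum f w := hh.unique hh.indefSum w hw

section Parameters

variable {E : Type*} [NormedAddCommGroup E] [NormedSpace ℂ E]

theorem isIndefSum_newtonSum {f : E × ℂ → ℂ} (hf : DifferentiableOn ℂ f (univ ×ˢ psiDomain)) {s₀ : E}
    {U : Set E} (hU : U ∈ nhds s₀) {C : ℝ} {B : ℕ}
    (hg : ∀ s ∈ U, HasGrowth (fun w => f (s, w)) C B) :
    IsIndefSum (fun w => f (s₀, w)) (newtonSum (B + 1) fun w => f (s₀, w)) where
  mem := by
    obtain ⟨K, A, h⟩ := exists_hasGrowth_newtonSum B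
    refine (h (hf.slice_re_pos s₀) (hg s₀ (mem_of_mem_nhds hU))).mem_stripAlgebra fun w hw => ?_
    have h1 := differentiableAt_newtonSum_prod hf hU hg hw
    exact (h1.comp w (f := fun w => (s₀, w)) (by fun_prop)).differentiableWithinAt
  apply_zero := newtonSum_zero _ _
  add_one := fun w _ =>
    (hg s₀ (mem_of_mem_nhds hU)).newtonSum_add_one (hf.slice_re_pos s₀) w

theorem HasHolomorphicGrowth.isIndefSum {f : E × ℂ → ℂ} (hf : HasHolomorphicGrowth f) (s : E) :
    IsIndefSum (fun w => f (s, w)) (indefSum fun w => f (s, w)) := by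
  obtain ⟨U, hU, C, B, hg⟩ := hf.growth s
  exact (isIndefSum_newtonSum hf.differentiableOn hU hg).indefSum

/-- Indefinite summation preserves holomorphy in parameters and polynomial growth. -/
theorem HasHolomorphicGrowth.indefSum {f : E × ℂ → ℂ} (hf : HasHolomorphicGrowth f) :
    HasHolomorphicGrowth fun p : E × ℂ => indefSum (fun w => f (p.1, w)) p.2 := by
  -- The degree of regularization `B + 1` varies with `s₀`. Uniqueness glues the local constructions
  -- into one function; passing to the interior makes the same `U` a neighbourhood of each of its
  -- points.
  have key : ∀ s₀, ∃ U ∈ nhds s₀, ∃ C B, (∀ s ∈ U, HasGrowth (fun w => f (s, w)) C B) ∧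
      ∀ s ∈ U, ∀ w ∈ psiDomain,
        newtonSum (B + 1) (fun w => f (s, w)) w = _root_.indefSum (fun w => f (s, w)) w := by
    intro s₀
    obtain ⟨U, hU, C, B, hg⟩ := hf.growth s₀
    refine ⟨interior U, interior_mem_nhds.2 hU, C, B, fun s hs => hg s (interior_subset hs), ?_⟩
    intro s hs w hw
    exact (isIndefSum_newtonSum hf.differentiableOn (mem_interior_iff_mem_nhds.1 hs) hg).eq_indefSum hw
  constructor
  · rintro ⟨s₀, w₀⟩ hp
    obtain ⟨U, hU, C, B, hg, he⟩ := key s₀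
    refine (DifferentiableAt.congr_of_eventuallyEq
      (differentiableAt_newtonSum_prod hf.differentiableOn hU hg hp.2) ?_).differentiableWithinAt
    filter_upwards [prod_mem_nhds hU (isShiftDomain_psiDomain.isOpen.mem_nhds hp.2)] with p hp
    exact (he p.1 hp.1 p.2 hp.2).symm
  · intro s₀
    obtain ⟨U, hU, C, B, hg, he⟩ := key s₀
    obtain ⟨K, A, h⟩ := exists_hasGrowth_newtonSum B
    refine ⟨U, hU, K * C, A, fun s hs w hw => ?_⟩
    have := h (hf.differentiableOn.slice_re_pos s) (hg s hs) w hw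
    rwa [he s hs w (isShiftDomain_psiDomain.mem_of_re w (by linarith))] at this

end Parameters

/-! ### Construction of the continuation of `Ψ` -/

theorem Complex.norm_cpow_le_exp_mul {z : ℂ} (hz : z ≠ 0) (s : ℂ) :
    ‖z ^ s‖ ≤ Real.exp (Real.pi * |s.im|) * ‖z‖ ^ s.re := by
  rw [norm_cpow_of_ne_zero hz, div_eq_mul_inv, ← Real.exp_neg, mul_comm]
  gcongr
  calc -(z.arg * s.im) ≤ |z.arg * s.im| := neg_le_abs _
    _ ≤ Real.pi * |s.im| := by
      rw [abs_mul]
      gcongr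
      exact abs_arg_le_pi z

theorem one_add_re_le_norm_add_one (w : ℂ) : 1 + w.re ≤ ‖w + 1‖ := by
  have := Complex.re_le_norm (w + 1)
  simp only [Complex.add_re, Complex.one_re] at this
  linarith

theorem add_one_ne_zero_of_mem_psiDomain {w : ℂ} (hw : w ∈ psiDomain) : w + 1 ≠ 0 :=
  Complex.slitPlane_ne_zero (mem_psiDomain_iff.1 hw)

theorem hasGrowth_cpow {s : ℂ} {N : ℕ} (hs : ‖s‖ ≤ N) :
    HasGrowth (fun w => (w + 1) ^ (-s)) (Real.exp (Real.pi * N)) N := by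
  intro w hw
  have h1 := one_add_re_le_norm_add_one w
  have h0 : w + 1 ≠ 0 := norm_pos_iff.1 (by linarith)
  have hre : -s.re ≤ N := (neg_le_abs _).trans ((Complex.abs_re_le_norm s).trans hs)
  refine (Complex.norm_cpow_le_exp_mul h0 _).trans ?_
  rw [Complex.neg_im, abs_neg, Complex.neg_re]
  gcongr
  · exact (Complex.abs_im_le_norm s).trans hs
  · calc ‖w + 1‖ ^ (-s.re) ≤ ‖w + 1‖ ^ (N : ℝ) :=
          Real.rpow_le_rpow_of_exponent_le (by linarith) hre
      _ = ‖w + 1‖ ^ N := Real.rpow_natCast _ _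
      _ ≤ (1 + ‖w‖) ^ N := by
          gcongr
          rw [add_comm 1]
          exact (norm_add_le _ _).trans_eq (by simp)

/-- The function `Ψ(s; w)` at arbitrary tuples, defined by iterated indefinite summation. -/
def psiSum : List ℂ → ℂ → ℂ
  | [] => fun _ => 1
  | s :: l => indefSum fun w => psiSum l w * (w + 1) ^ (-s)

theorem psiSum_nil (w : ℂ) : psiSum [] w = 1 := rfl

/-- The inductive step in the depth, before summation: a new first exponent enters. The growth
exponent increases by any integer `N` above `‖s₀ 0‖`, which remains valid near `s₀`. -/
theorem HasHolomorphicGrowth.mul_cpow {d : ℕ} {F : (Fin d → ℂ) × ℂ → ℂ}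
    (hF : HasHolomorphicGrowth F) : HasHolomorphicGrowth fun p : (Fin (d + 1) → ℂ) × ℂ =>
      F (Fin.tail p.1, p.2) * (p.2 + 1) ^ (-(p.1 0)) := by
  have htail : Differentiable ℂ fun s : Fin (d + 1) → ℂ => Fin.tail s :=
    differentiable_pi.2 fun i => differentiable_apply (i.succ : Fin (d + 1))
  constructor
  · refine DifferentiableOn.mul ?_ ?_
    · exact hF.differentiableOn.comp (f := fun p : (Fin (d + 1) → ℂ) × ℂ => (Fin.tail p.1, p.2))
        ((htail.comp differentiable_fst).prodMk differentiable_snd).differentiableOn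
        fun p hp => ⟨trivial, hp.2⟩
    · exact DifferentiableOn.cpow (by fun_prop) (by fun_prop) fun p hp => mem_psiDomain_iff.1 hp.2
  · intro s₀
    obtain ⟨U, hU, C, B, hg⟩ := hF.growth (Fin.tail s₀)
    obtain ⟨N, hN⟩ := exists_nat_gt ‖s₀ 0‖
    have hc : Continuous fun s : Fin (d + 1) → ℂ => ‖s 0‖ := by fun_prop
    refine ⟨_, Filter.inter_mem (htail.continuous.continuousAt hU)
      (hc.continuousAt.eventually_lt_const hN), C * Real.exp (Real.pi * N), B + N, ?_⟩
    rintro s ⟨hs1, hs2⟩ w hw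
    have hs2' : ‖s 0‖ < N := hs2
    rw [norm_mul, pow_add]
    have e1 := hg _ hs1 w hw
    calc _ ≤ (C * (1 + ‖w‖) ^ B) * (Real.exp (Real.pi * N) * (1 + ‖w‖) ^ N) :=
          mul_le_mul e1 (hasGrowth_cpow hs2'.le w hw) (norm_nonneg _) ((norm_nonneg _).trans e1)
      _ = _ := by ring

theorem psiSum_ofFn_succ {d : ℕ} (s : Fin (d + 1) → ℂ) : psiSum (List.ofFn s)
    = indefSum fun w => psiSum (List.ofFn (Fin.tail s)) w * (w + 1) ^ (-(s 0)) := by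
  rw [List.ofFn_succ, psiSum]
  rfl

theorem hasHolomorphicGrowth_psiSum (d : ℕ) :
    HasHolomorphicGrowth fun p : (Fin d → ℂ) × ℂ => psiSum (List.ofFn p.1) p.2 := by
  induction d with
  | zero =>
    simp only [List.ofFn_zero, psiSum_nil]
    exact ⟨differentiableOn_const _, fun s₀ => ⟨univ, Filter.univ_mem, 1, 0, fun _ _ w _ => by simp⟩⟩
  | succ d ih =>
    simp only [psiSum_ofFn_succ]
    exact ih.mul_cpow.indefSum

theorem isIndefSum_psiSum (s : ℂ) (l : List ℂ) :
    IsIndefSum (fun w => psiSum l w * (w + 1) ^ (-s)) (psiSum (s :: l)) := by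
  have := (hasHolomorphicGrowth_psiSum l.length).mul_cpow.isIndefSum (Fin.cons s l.get)
  simp only [Fin.tail_cons, Fin.cons_zero, List.ofFn_get] at this
  exact this

theorem differentiableOn_psiSum (l : List ℂ) : DifferentiableOn ℂ (psiSum l) psiDomain := by
  have := (hasHolomorphicGrowth_psiSum l.length).differentiableOn.slice l.get
  simpa only [List.ofFn_get] using this

theorem psiSum_mem_stripAlgebra (l : List ℂ) : psiSum l ∈ stripAlgebra psiDomain := by
  cases l with
  | nil => exact (stripAlgebra psiDomain).one_mem
  | cons s l => exact (isIndefSum_psiSum s l).mem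

/-- If `f` decays fast enough, then its normalized indefinite sum is given by a series. -/
theorem isIndefSum_tsum {f : ℂ → ℂ} (hf : DifferentiableOn ℂ f psiDomain) {u : ℕ → ℝ}
    (hu : Summable u) (hb : ∀ w : ℂ, 0 ≤ w.re → ∀ j : ℕ, ‖f (w + j)‖ ≤ u j) :
    HasGrowth (fun w => ∑' j : ℕ, (f j - f (w + j))) (∑' j, 2 * u j) 0 ∧
      IsIndefSum f fun w => ∑' j : ℕ, (f j - f (w + j)) := by
  have hb0 : ∀ j : ℕ, ‖f j‖ ≤ u j := fun j => by simpa using hb 0 le_rfl j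
  have hs0 : Summable fun j : ℕ => f j := Summable.of_norm_bounded hu hb0
  have hs : ∀ w : ℂ, Summable fun j : ℕ => f (w + j) := by
    intro w
    obtain ⟨J, hJ⟩ := exists_nat_gt (-w.re)
    refine (summable_nat_add_iff J).1 (Summable.of_norm_bounded hu fun j => ?_)
    have := hb (w + J) (by simp; linarith) j
    push_cast
    rwa [add_comm (j : ℂ), ← add_assoc]
  have hgr : HasGrowth (fun w => ∑' j : ℕ, (f j - f (w + j))) (∑' j, 2 * u j) 0 := by
    intro w hw
    rw [pow_zero, mul_one]
    refine tsum_of_norm_bounded (hu.mul_left 2).hasSum fun j => (norm_sub_le _ _).trans ?_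
    linarith [hb0 j, hb w hw j]
  refine ⟨hgr, hgr.mem_stripAlgebra fun w₀ hw₀ => DifferentiableAt.differentiableWithinAt ?_,
    by simp, fun w _ => ?_⟩
  · obtain ⟨r, hr, hball⟩ := Metric.mem_nhds_iff.1 (Filter.inter_mem
      (isShiftDomain_psiDomain.isOpen.mem_nhds hw₀) (ball_mem_nhds w₀ one_pos))
    -- The bound `hb` is available only for `Re ≥ 0`. After `J` shifts the unit ball about `w₀` lies
    -- there, so the term with index `j = J + i` is dominated by `u i`, that is `u (j - J)`.
    obtain ⟨J, hJ⟩ := exists_nat_gt (1 - w₀.re)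
    have hu' : Summable fun j : ℕ => u j + u (j - J) :=
      hu.add ((summable_nat_add_iff J).1 (by simpa using hu))
    refine differentiableAt_tsum_of_eventually_norm_le hr hu' J (fun j => ?_) ?_
    · exact (differentiableOn_const _).sub (hf.comp (by fun_prop) fun w hw =>
        isShiftDomain_psiDomain.add_nat (hball hw).1 j)
    · intro j hj w hw
      obtain ⟨i, rfl⟩ := Nat.exists_eq_add_of_le hj
      have h1 : |(w - w₀).re| < 1 :=
        (Complex.abs_re_le_norm _).trans_lt (by simpa [dist_eq_norm] using (hball hw).2)
      have h2 := (abs_lt.1 h1).1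
      rw [Complex.sub_re] at h2
      have := hb (w + J) (by simp; linarith) i
      rw [Nat.add_sub_cancel_left]
      refine (norm_sub_le _ _).trans (add_le_add (hb0 _) ?_)
      push_cast
      rwa [← add_assoc]
  · rw [hs0.tsum_sub (hs (w + 1)), hs0.tsum_sub (hs w), (hs w).tsum_eq_zero_add]
    have : ∀ j : ℕ, w + (j + 1 : ℕ) = w + 1 + j := fun j => by push_cast; ring
    simp only [this, Nat.cast_zero, add_zero]
    ring

/-- The defining series is an indefinite sum of polynomial growth, hence the normalized one by
uniqueness. Boundedness for `Re w ≥ 0` is carried along the induction because it makes the next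
summand `O(j ^ (-s.re))`. -/
theorem psiSeries_eq_psiSum (l : List ℂ) (hl : ∀ s ∈ l, 1 < s.re) :
    (∃ C, HasGrowth (psiSum l) C 0) ∧ ∀ w ∈ psiDomain, psiSeries l w = psiSum l w := by
  induction l with
  | nil => exact ⟨⟨1, fun w _ => by simp [psiSum_nil]⟩, fun w _ => by rw [psiSeries, psiSum_nil]⟩
  | cons s l ih =>
    obtain ⟨⟨C, hC⟩, he⟩ := ih fun t ht => hl t (List.mem_cons_of_mem s ht)
    have hs : 1 < s.re := hl s List.mem_cons_self
    have hC0 := hC.nonneg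
    let f : ℂ → ℂ := fun w => psiSum l w * (w + 1) ^ (-s)
    have hf : DifferentiableOn ℂ f psiDomain :=
      (differentiableOn_psiSum l).mul (DifferentiableOn.cpow (by fun_prop) (by fun_prop)
        fun w hw => mem_psiDomain_iff.1 hw)
    have hu : Summable fun j : ℕ =>
        C * (Real.exp (Real.pi * |s.im|) * (1 + (j : ℝ)) ^ (-s.re)) := by
      refine ((((summable_nat_add_iff 1).2 (Real.summable_nat_rpow.2
        (by linarith : -s.re < -1))).mul_left
        (Real.exp (Real.pi * |s.im|))).mul_left C).congr fun j => ?_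
      push_cast
      rw [add_comm (j : ℝ)]
    have hb : ∀ w : ℂ, 0 ≤ w.re → ∀ j : ℕ, ‖f (w + j)‖
        ≤ C * (Real.exp (Real.pi * |s.im|) * (1 + (j : ℝ)) ^ (-s.re)) := by
      intro w hw j
      have hj : (0 : ℝ) ≤ j := Nat.cast_nonneg j
      have hre : 0 ≤ (w + j).re := by simp; linarith
      have h1 := one_add_re_le_norm_add_one (w + j)
      have h2 : 1 + (j : ℝ) ≤ ‖w + j + 1‖ := by
        refine le_trans ?_ h1
        simpa using hw
      have h0 : w + j + 1 ≠ 0 := norm_pos_iff.1 (by linarith)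
      have h3 := hC (w + j) hre
      rw [pow_zero, mul_one] at h3
      have h4 := Complex.norm_cpow_le_exp_mul h0 (-s)
      rw [Complex.neg_im, abs_neg, Complex.neg_re] at h4
      have h5 : ‖w + j + 1‖ ^ (-s.re) ≤ (1 + (j : ℝ)) ^ (-s.re) :=
        Real.rpow_le_rpow_of_nonpos (by linarith) h2 (by linarith)
      calc ‖f (w + j)‖ = ‖psiSum l (w + j)‖ * ‖(w + j + 1) ^ (-s)‖ := norm_mul _ _
        _ ≤ C * (Real.exp (Real.pi * |s.im|) * ‖w + j + 1‖ ^ (-s.re)) := by gcongr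
        _ ≤ _ := by gcongr
    obtain ⟨C', hgr⟩ : ∃ C', HasGrowth (fun w => ∑' j : ℕ, (f j - f (w + j))) C' 0 :=
      ⟨_, (isIndefSum_tsum hf hu hb).1⟩
    have hind := (isIndefSum_tsum hf hu hb).2
    have heq := hind.unique (isIndefSum_psiSum s l)
    refine ⟨⟨C', fun w hw => ?_⟩, fun w hw => ?_⟩
    · rw [← heq w (isShiftDomain_psiDomain.mem_of_re w (by linarith))]
      exact hgr w hw
    · rw [← heq w hw, psiSeries]
      refine tsum_congr fun j => ?_
      rw [he j (natCast_mem_psiDomain j), he (w + j) (isShiftDomain_psiDomain.add_nat hw j)]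
      simp only [f, Complex.cpow_neg, div_eq_mul_inv, add_assoc]

theorem isPsiContinuation_psiSum (d : ℕ) :
    IsPsiContinuation d fun p => psiSum (List.ofFn p.1) p.2 where
  differentiableOn := (hasHolomorphicGrowth_psiSum d).differentiableOn
  eq_series := fun s hs w hw => ((psiSeries_eq_psiSum (List.ofFn s) (by
    intro t ht
    obtain ⟨i, rfl⟩ := (List.mem_ofFn' s t).1 ht
    exact hs i)).2 w hw).symm

/-- The iterated indefinite sums witness that a continuation exists, so the choice by
`Classical.epsilon` is a genuine one. -/
theorem isPsiContinuation_psiContinuation (d : ℕ) : IsPsiContinuation d (psiContinuation d) :=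
  Classical.epsilon_spec (p := IsPsiContinuation d) ⟨_, isPsiContinuation_psiSum d⟩

theorem Psi_eq_psiSum (s : List ℂ) {w : ℂ} (hw : w ∈ psiDomain) : Psi s w = psiSum s w := by
  rw [Psi, (isPsiContinuation_psiContinuation _).unique (isPsiContinuation_psiSum _) _ w hw]
  simp only [List.ofFn_get]

/-- The weight `(w + 1) ^ (-a)` turns addition of exponents into multiplication: the base is fixed
and nonzero on `psiDomain`, so one logarithm serves both factors. -/
theorem psiMap_tuple_mul_tuple {w : ℂ} (hw : w ∈ psiDomain) (x y : List (Multiplicative ℂ)) :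
    psiMap w (HarmonicAlgebra.tuple x * HarmonicAlgebra.tuple y)
      = Psi (x.map Multiplicative.toAdd) w * Psi (y.map Multiplicative.toAdd) w := by
  have := HarmonicAlgebra.extend_tupleMul_apply isShiftDomain_psiDomain
    (e := fun (a : Multiplicative ℂ) w => (w + 1) ^ (-a.toAdd))
    (Φ := fun l w => psiSum (l.map Multiplicative.toAdd) w) ?_ (fun w _ => psiSum_nil w)
    (fun l => psiSum_mem_stripAlgebra _) (fun a l => (isIndefSum_psiSum _ _).apply_zero) ?_ x y w hw
  · rw [psiMap]
    simp only [Psi_eq_psiSum _ hw]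
    exact this
  · intro a b w hw
    simp only [toAdd_mul, neg_add]
    exact Complex.cpow_add _ _ (add_one_ne_zero_of_mem_psiDomain hw)
  · intro a l w hw
    have := (isIndefSum_psiSum a.toAdd (l.map Multiplicative.toAdd)).add_one w hw
    simp only [List.map_cons, this]
    ring

/-! ### From tuples to algebra homomorphisms -/

/-- A linear map that is multiplicative on tuples is an algebra homomorphism. -/
theorem HarmonicAlgebra.exists_algHom_toLinearMap_eq {X : Type*} [CommSemigroup X]
    {f : HarmonicAlgebra X →ₗ[ℚ] ℂ} (h1 : f 1 = 1)
    (hmul : ∀ x y, f (tuple x * tuple y) = f (tuple x) * f (tuple y)) :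
    ∃ φ : HarmonicAlgebra X →ₐ[ℚ] ℂ, φ.toLinearMap = f := by
  refine ⟨AlgHom.ofLinearMap f h1 fun u v => ?_, rfl⟩
  induction u using induction_tuple with
  | h0 => simp
  | hadd u u' hu hu' => rw [add_mul, map_add, map_add, hu, hu', add_mul]
  | hsmul c u hu => rw [smul_mul_assoc, map_smul, map_smul, hu, smul_mul_assoc]
  | ht x =>
    induction v using induction_tuple with
    | h0 => simp
    | hadd u u' hu hu' => rw [mul_add, map_add, map_add, hu, hu', mul_add]
    | hsmul c u hu => rw [mul_smul_comm, map_smul, map_smul, hu, mul_smul_comm]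
    | ht y => exact hmul x y

end

theorem theorem5p2 :
    (∀ d : ℕ, IsPsiContinuation d (psiContinuation d)) ∧
    (∀ w ∈ psiDomain,
      (∃ φ : HarmonicAlgebraS →ₐ[ℚ] ℂ, φ.toLinearMap = psiMap w) ∧
      ∀ t s : List ℂ,
        Psi t w * Psi s w =
          psiMap w (HarmonicAlgebra.tuple (t.map Multiplicative.ofAdd) *
            HarmonicAlgebra.tuple (s.map Multiplicative.ofAdd))) ∧
    (∀ w : ℂ,
      (∃ φ : HarmonicAlgebraQ →ₐ[ℚ] ℂ, φ.toLinearMap = gMap w) ∧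
      ∀ p q : List {x : ℝ // 0 < x},
        G (p.map fun x : {x : ℝ // 0 < x} => ((x : ℝ) : ℂ)) w *
            G (q.map fun x : {x : ℝ // 0 < x} => ((x : ℝ) : ℂ)) w =
          gMap w (HarmonicAlgebra.tuple p * HarmonicAlgebra.tuple q)) := by
  refine ⟨isPsiContinuation_psiContinuation, fun w hw => ⟨?_, fun t s => ?_⟩,
    fun w => ⟨?_, G_harmonic w⟩⟩
  · refine HarmonicAlgebra.exists_algHom_toLinearMap_eq ?_ fun x y => ?_
    · rw [HarmonicAlgebra.one_def, psiMap, HarmonicAlgebra.extend_tuple, List.map_nil,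
        Psi_eq_psiSum _ hw, psiSum_nil]
    · rw [psiMap_tuple_mul_tuple hw, psiMap, HarmonicAlgebra.extend_tuple,
        HarmonicAlgebra.extend_tuple]
  · rw [psiMap_tuple_mul_tuple hw]
    simp [Function.comp_def]
  · refine HarmonicAlgebra.exists_algHom_toLinearMap_eq ?_ fun x y => ?_
    · rw [HarmonicAlgebra.one_def, gMap, HarmonicAlgebra.extend_tuple, List.map_nil, G_nil]
    · rw [← G_harmonic, gMap, HarmonicAlgebra.extend_tuple, HarmonicAlgebra.extend_tuple]
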